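/- **Setting.** All quantum systems have separable Hilbert spaces. Let $\mathcal N_{\vec{A'}\vec B\to\vec A\vec C}$ be a multiplex quantum channel (a completely positive trace-preserving map, in operator-sum form) among finitely many trusted parties: party $\mathsf A_a$ inputs $A'_a$ and receives $A_a$, party $\mathsf B_b$ only inputs $B_b$, party $\mathsf C_c$ only receives $C_c$. Reference systems $L_a,R_b,P_c$ are kept by $\mathsf A_a,\mathsf B_b,\mathsf C_c$; the channel acts as the identity on them. A state is *fully separable* ($\mathrm{FS}$) for a given partition of the systems among the parties if it is a countable convex combination $\sum_x p_x|\psi_x\rangle\langle\psi_x|$ of pure states that are products over all the parties, and *biseparable* ($\mathrm{BS}$) if it is a countable convex combination of pure states each of which is a product with respect to some bipartition of the set of parties into two nonempty sets (the bipartition may depend on the term). Let $$D^\varepsilon_h(\rho\Vert\sigma)=-\log_2\inf\{\operatorname{Tr}[\Lambda\sigma]:0\le\Lambda\le 1,\ \operatorname{Tr}[\Lambda\rho]\ge 1-\varepsilon\},\qquad F(\rho,\sigma)=\Big[\operatorname{Tr}\sqrt{\sqrt\sigma\rho\sqrt\sigma}\Big]^2,$$ with $-\log_2 0=+\infty$ (and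 $\inf\emptyset=+\infty$ below), and $$E^\varepsilon_{h,\mathrm{GE}}(\mathcal N)=\sup_{\psi\in\mathrm{FS}(:\vec{LA'}:\vec{RB}:)}\ \inf_{\sigma\in\mathrm{BS}(:\vec{LA}:\vec R:\vec C:)}D^\varepsilon_h(\mathcal N(\psi)\Vert\sigma),$$ where the supremum is over all reference systems $\vec L,\vec R$ and all such $\psi$. A *private state* with key size $K$ is a state $\gamma_{\vec{SK}}=U(\Phi^{\mathrm{GHZ}}_{\vec K}\otimes\omega_{\vec S})U^\dagger$, where each party $i$ holds a $K$-dimensional key system $K_i$ and a shield system $S_i$, $\Phi^{\mathrm{GHZ}}=\frac1K\sum_{k,l}|k\cdots k\rangle\langle l\cdots l|$, $\omega$ is a density operator and $U=\sum_{\vec k}|\vec k\rangle\langle\vec k|\otimes U^{\vec k}_{\vec S}$ with unitaries $U^{\vec k}_{\vec S}$. An *LOCC channel* is a channel of the form $\sum_x\bigotimes_i\mathcal E^{i,x}$, with $x$ in a countable alphabet and $\mathcal E^{i,x}$ a completely positive trace-non-increasing map of party $i$. A $(1,K,\varepsilon)$ *cppp-assisted conference key agreement protocol* over $\mathcal N$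 consists of a state $\rho\in\mathrm{FS}(:\vec{LA'}:\vec{RB}:\vec P:)$ (prepared by the first LOCC), one use of $\mathcal N$, and an LOCC channel $\mathcal D$ among all parties, such that $F(\gamma,\mathcal D(\mathcal N(\rho)))\ge 1-\varepsilon$ for some private state $\gamma$ with key size $K\ge 1$. An $(n,K,\varepsilon)$ cppp-assisted protocol over $\mathcal N$ is a $(1,K,\varepsilon)$ protocol over $\mathcal N^{\otimes n}$ (regarded as a multiplex channel with systems $A_a'^{\,n},B_b^{\,n},A_a^{\,n},C_c^{\,n}$). Let $\hat P^{\mathcal N}_{\mathrm{cppp}}(n,\varepsilon)$ be the supremum of $\frac1n\log_2K$ over all $K$ for which an $(n,K,\varepsilon)$ cppp-assisted protocol over $\mathcal N$ exists. **Theorem.** For every multiplex channel $\mathcal N$ and every $\varepsilon\in(0,1)$: 1. $\hat P^{\mathcal N}_{\mathrm{cppp}}(1,\varepsilon)\le E^\varepsilon_{h,\mathrm{GE}}(\mathcal N)$. 2. It suffices to optimise over pure inputs: the supremum in $E^\varepsilon_{h,\mathrm{GE}}(\mathcal N)$ is unchanged if $\psi$ is restricted to pure states in $\mathrm{FS}(:\vec{LA'}:\vec{RB}:)$.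 3. For every integer $n\ge1$, $\hat P^{\mathcal N}_{\mathrm{cppp}}(n,\varepsilon)\le\frac1n E^\varepsilon_{h,\mathrm{GE}}(\mathcal N^{\otimes n})$. -/

import Mathlib

open scoped lp

noncomputable section

namespace CKA

/-- The separable Hilbert space `ℓ²(X)` with orthonormal basis indexed by the countable set `X`
(every separable Hilbert space is of this form). The tensor product of `ℓ²(X i)`, `i ∈ ι`, is
`ℓ²(∀ i, X i)`, and the tensor product of `ℓ²(X)` and `ℓ²(Y)` is `ℓ²(X × Y)`. -/
abbrev Hil (X : Type) : Type := ℓ²(X, ℂ)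
/-- Bounded operators. -/
abbrev Op (X Y : Type) : Type := Hil X →L[ℂ] Hil Y

open Classical in
/-- The basis vector `|x⟩`. -/
def ket {X : Type} (x : X) : Hil X := lp.single 2 x (1 : ℂ)

/-- The matrix element `⟨y|T|x⟩`. -/
def entry {X Y : Type} (T : Op X Y) (y : Y) (x : X) : ℂ := T (ket x) y

open Classical in
theorem ket_apply {X : Type} (x x' : X) : ket x x' = if x' = x then 1 else 0 := by
  unfold ket
  rw [lp.single_apply, Pi.single_apply]

theorem op_ext {X Y : Type} {S T : Op X Y} (h : ∀ y x, entry S y x = entry T y x) : S = T := by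
  classical
  apply lp.ext_continuousLinearMap (by norm_num)
  intro x
  ext y
  have e : ∀ c : ℂ, (lp.single 2 x c : Hil X) = c • ket x := by
    intro c
    unfold ket
    rw [← lp.single_smul]; simp
  have := h y x
  simp only [entry] at this
  simp [e, this]

/-- The bounded operator with matrix `m` in the standard bases (unique by `op_ext`). It is only used
for matrices for which it exists; existence is proved below in each case. -/
def opOfMatrix {X Y : Type} (m : Y → X → ℂ) : Op X Y :=
  open Classical in
  if h : ∃ S : Op X Y, ∀ y x, entry S y x = m y x then h.choose else 0

theorem entry_opOfMatrix {X Y : Type} {m : Y → X → ℂ}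
    (h : ∃ S : Op X Y, ∀ y x, entry S y x = m y x) (y : Y) (x : X) :
    entry (opOfMatrix m) y x = m y x := by
  unfold opOfMatrix
  rw [dif_pos h]
  exact h.choose_spec y x

theorem hasSum_norm_sq {X : Type} (f : Hil X) : HasSum (fun x => ‖f x‖ ^ 2) (‖f‖ ^ 2) := by
  have := lp.hasSum_norm (p := 2) (by norm_num) f
  simpa using this

theorem memlp_two {X : Type} {f : X → ℂ} (h : Summable fun x => ‖f x‖ ^ 2) :
    Memℓp (E := fun _ : X => ℂ) f 2 := by
  apply memℓp_gen
  simpa using h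

/-- The operator `f ↦ f ∘ g` for an injective map `g` of basis labels. -/
def pull {X Y : Type} (g : X → Y) (hg : Function.Injective g) : Op Y X :=
  LinearMap.mkContinuous
    { toFun := fun f => ⟨fun x => f (g x),
        memlp_two ((hasSum_norm_sq f).summable.comp_injective hg)⟩
      map_add' := fun _ _ => by ext; rfl
      map_smul' := fun _ _ => by ext; rfl } 1 (by
    intro f
    rw [one_mul]
    refine le_of_sq_le_sq ?_ (norm_nonneg _)
    rw [← (hasSum_norm_sq f).tsum_eq, ← (hasSum_norm_sq _).tsum_eq]
    exact tsum_comp_le_tsum_of_inj (hasSum_norm_sq f).summable (fun _ => by positivity) hg)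

theorem exists_reindex {X Y X' Y' : Type} (T : Op X Y) (eX : X' ≃ X) (eY : Y' ≃ Y) :
    ∃ S : Op X' Y', ∀ y x, entry S y x = entry T (eY y) (eX x) := by
  refine ⟨(pull eY eY.injective).comp (T.comp (pull eX.symm eX.symm.injective)), fun y x => ?_⟩
  have : pull eX.symm eX.symm.injective (ket x) = ket (eX x) := by
    ext z
    change ket x (eX.symm z) = _
    rw [ket_apply, ket_apply]
    by_cases h : z = eX x
    · simp [h]
    · simp [h, Equiv.symm_apply_eq]
  simp only [entry, ContinuousLinearMap.comp_apply, this]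
  rfl

theorem exists_push {X Y : Type} (g : X → Y) (hg : Function.Injective g) :
    ∃ S : Op X Y, ∀ y x, entry S y x = (open Classical in if y = g x then 1 else 0) := by
  classical
  refine ⟨ContinuousLinearMap.adjoint (pull g hg), fun y x => ?_⟩
  have h1 : ∀ (v : Hil Y), v y = inner ℂ (ket y) v := by
    intro v; unfold ket; rw [lp.inner_single_left]; simp
  rw [entry, h1, ContinuousLinearMap.adjoint_inner_right]
  unfold ket
  rw [lp.inner_single_right]
  change inner ℂ (ket y (g x)) 1 = _
  simp only [ket_apply, eq_comm]
  split_ifs <;> simp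

theorem exists_ampliation (Z : Type) {X Y : Type} (T : Op X Y) :
    ∃ S : Op (Z × X) (Z × Y), ∀ y x,
      entry S y x = (open Classical in if y.1 = x.1 then entry T y.2 x.2 else 0) := by
  classical
  let sl : Z → Hil (Z × X) →ₗ[ℂ] Hil X := fun z =>
    (pull (fun x : X => (z, x)) (Prod.mk_right_injective z)).toLinearMap
  have hs : ∀ f : Hil (Z × X), HasSum (fun z => ‖sl z f‖ ^ 2) (‖f‖ ^ 2) := by
    intro f
    exact (hasSum_norm_sq f).prod_fiberwise fun z => hasSum_norm_sq (sl z f)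
  have hle : ∀ (f : Hil (Z × X)) z, ‖T (sl z f)‖ ^ 2 ≤ ‖T‖ ^ 2 * ‖sl z f‖ ^ 2 := by
    intro f z
    rw [← mul_pow]
    gcongr
    exact T.le_opNorm _
  have hsum : ∀ f : Hil (Z × X), Summable fun z => ‖T (sl z f)‖ ^ 2 := fun f =>
    Summable.of_nonneg_of_le (fun _ => by positivity) (hle f) ((hs f).summable.mul_left _)
  have hp : ∀ f : Hil (Z × X), Summable fun p : Z × Y => ‖T (sl p.1 f) p.2‖ ^ 2 := by
    intro f
    rw [summable_prod_of_nonneg (fun _ => by positivity)]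
    refine ⟨fun z => (hasSum_norm_sq (T (sl z f))).summable, ?_⟩
    simpa only [(hasSum_norm_sq _).tsum_eq] using hsum f
  let L : Hil (Z × X) →ₗ[ℂ] Hil (Z × Y) :=
    { toFun := fun f => ⟨fun p => T (sl p.1 f) p.2, memlp_two (hp f)⟩
      map_add' := fun f g => by ext p; simp only [map_add]; rfl
      map_smul' := fun c f => by ext p; simp only [map_smul]; rfl }
  refine ⟨L.mkContinuous ‖T‖ fun f => ?_, fun y x => ?_⟩
  · refine le_of_sq_le_sq ?_ (by positivity)
    have h2 : HasSum (fun z => ‖T (sl z f)‖ ^ 2) (‖L f‖ ^ 2) :=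
      (hasSum_norm_sq (L f)).prod_fiberwise fun z => hasSum_norm_sq (T (sl z f))
    rw [mul_pow]
    exact hasSum_le (hle f) h2 ((hs f).mul_left _)
  · change T (sl y.1 (ket x)) y.2 = _
    have : sl y.1 (ket x) = if y.1 = x.1 then ket x.2 else 0 := by
      ext z
      change ket x (y.1, z) = _
      rw [ket_apply]
      by_cases h : y.1 = x.1
      · simp [h, ket_apply, Prod.ext_iff]
      · simp [h, Prod.ext_iff]
    rw [this]
    split_ifs <;> simp [entry]

theorem apply_eq_of_comp {X Y Z : Type} (S : Op Y Z) (T : Op X Y) (z : Z) (x : X) (y : Y)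
    (hT : ∀ y', y' ≠ y → entry T y' x * entry S z y' = 0) :
    entry (S.comp T) z x = entry T y x * entry S z y := by
  classical
  have h1 := (lp.hasSum_single (p := 2) (by norm_num) (T (ket x))).mapL S
  have h2 : HasSum (fun y' => entry T y' x * entry S z y') (entry (S.comp T) z x) := by
    have h3 := h1.mapL (lp.evalCLM ℂ (fun _ : Z => ℂ) 2 z)
    refine Eq.mp (congrArg (fun u => HasSum u _) (funext fun y' => ?_)) h3
    have e : ∀ c : ℂ, (lp.single 2 y' c : Hil Y) = c • ket y' := by
      intro c
      unfold ket
      rw [← lp.single_smul]; simp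
    simp only [e, map_smul, smul_eq_mul]
    rfl
  exact h2.unique (hasSum_single y hT)

theorem exists_tensor_two {X Y X' Y' : Type} (T : Op X Y) (T' : Op X' Y') :
    ∃ S : Op (X × X') (Y × Y'), ∀ y x, entry S y x = entry T y.1 x.1 * entry T' y.2 x.2 := by
  classical
  obtain ⟨S1, h1⟩ := exists_ampliation X' T
  obtain ⟨S2, h2⟩ := exists_ampliation Y T'
  obtain ⟨S1', h1'⟩ := exists_reindex S1 (Equiv.prodComm X X') (Equiv.prodComm Y X')
  refine ⟨S2.comp S1', fun y x => ?_⟩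
  rw [apply_eq_of_comp S2 S1' y x (y.1, x.2)]
  · simp [h1', h1, h2]
  · intro p hp
    simp only [h1', h1, h2, Equiv.prodComm_apply, Prod.fst_swap, Prod.snd_swap]
    by_cases ha : p.2 = x.2
    · have : y.1 ≠ p.1 := fun hb => hp (Prod.ext hb.symm ha)
      simp [this]
    · simp [ha]

theorem exists_tensor_fin : ∀ (n : ℕ) (X Y : Fin n → Type) (T : ∀ i, Op (X i) (Y i)),
    ∃ S : Op (∀ i, X i) (∀ i, Y i), ∀ y x, entry S y x = ∏ i, entry (T i) (y i) (x i)
  | 0, X, Y, _ => by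
    refine ⟨(exists_reindex (ContinuousLinearMap.id ℂ (Hil Unit)) (Equiv.equivPUnit _)
      (Equiv.equivPUnit _)).choose, fun y x => ?_⟩
    rw [(exists_reindex (ContinuousLinearMap.id ℂ (Hil Unit)) (Equiv.equivPUnit _)
      (Equiv.equivPUnit _)).choose_spec]
    simp [entry, ket_apply]
  | n + 1, X, Y, T => by
    obtain ⟨S, hS⟩ := exists_tensor_fin n (fun i => X i.succ) (fun i => Y i.succ)
      (fun i => T i.succ)
    obtain ⟨S', hS'⟩ := exists_tensor_two (T 0) S
    obtain ⟨R, hR⟩ := exists_reindex S' (Fin.consEquiv X).symm (Fin.consEquiv Y).symm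
    refine ⟨R, fun y x => ?_⟩
    rw [hR, hS', hS, Fin.prod_univ_succ]
    rfl

theorem exists_tensor {ι : Type} [Fintype ι] {X Y : ι → Type} (T : ∀ i, Op (X i) (Y i)) :
    ∃ S : Op (∀ i, X i) (∀ i, Y i), ∀ y x, entry S y x = ∏ i, entry (T i) (y i) (x i) := by
  let e := (Fintype.equivFin ι).symm
  obtain ⟨S, hS⟩ := exists_tensor_fin _ (fun j => X (e j)) (fun j => Y (e j)) (fun j => T (e j))
  obtain ⟨R, hR⟩ := exists_reindex S (Equiv.piCongrLeft X e).symm (Equiv.piCongrLeft Y e).symm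
  refine ⟨R, fun y x => ?_⟩
  rw [hR, hS, ← Equiv.prod_comp e]
  rfl

/-- The tensor product `⨂ i, T i` of bounded operators. -/
def tensorOp {ι : Type} [Fintype ι] {X Y : ι → Type} (T : ∀ i, Op (X i) (Y i)) :
    Op (∀ i, X i) (∀ i, Y i) :=
  opOfMatrix fun y x => ∏ i, entry (T i) (y i) (x i)

theorem entry_tensorOp {ι : Type} [Fintype ι] {X Y : ι → Type} (T : ∀ i, Op (X i) (Y i))
    (y : ∀ i, Y i) (x : ∀ i, X i) :
    entry (tensorOp T) y x = ∏ i, entry (T i) (y i) (x i) :=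
  entry_opOfMatrix (exists_tensor T) y x

/-! ### States, trace, fidelity, hypothesis testing -/

/-- The trace in the standard basis. -/
def tr {X : Type} (T : Op X X) : ℂ := ∑' x, entry T x x

/-- Density operators: positive operators of trace one. -/
def IsDensity {X : Type} (ρ : Op X X) : Prop :=
  ρ.IsPositive ∧ HasSum (fun x => entry ρ x x) 1

/-- The rank-one operator `|ψ⟩⟨ψ|`. -/
def proj {X : Type} (ψ : Hil X) : Op X X := InnerProductSpace.rankOne ℂ ψ ψ

/-- Pure states. -/
def IsPure {X : Type} (ρ : Op X X) : Prop := ∃ ψ : Hil X, ‖ψ‖ = 1 ∧ ρ = proj ψ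

/-- The positive square root of a positive bounded operator on a Hilbert space. -/
def opSqrt {H : Type} [NormedAddCommGroup H] [InnerProductSpace ℂ H] [CompleteSpace H]
    (T : H →L[ℂ] H) : H →L[ℂ] H :=
  CFC.sqrt T

/-- The fidelity `F(ρ, σ) = (Tr √(√σ ρ √σ))²`. -/
def fidelity {X : Type} (ρ σ : Op X X) : ℝ :=
  (tr (opSqrt (opSqrt σ ∘L ρ ∘L opSqrt σ))).re ^ 2

/-- The smallest error of the second kind, `inf Tr[Λσ]` over tests `0 ≤ Λ ≤ 1` with
`Tr[Λρ] ≥ 1 - ε`. -/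
def optimalError {X : Type} (ε : ℝ) (ρ σ : Op X X) : ℝ :=
  sInf {t : ℝ | ∃ Λ : Op X X, 0 ≤ Λ ∧ Λ ≤ 1 ∧ 1 - ε ≤ (tr (Λ ∘L ρ)).re ∧ t = (tr (Λ ∘L σ)).re}

/-- The `ε`-hypothesis-testing divergence `-log₂ (optimalError ε ρ σ)`, with `-log₂ 0 = ⊤`. -/
def hypothesisTestingDivergence {X : Type} (ε : ℝ) (ρ σ : Op X X) : EReal :=
  if optimalError ε ρ σ ≤ 0 then ⊤ else ((-Real.logb 2 (optimalError ε ρ σ) : ℝ) : EReal)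

/-! ### Fully separable and biseparable states -/

/-- `ρ = ∑ₙ pₙ |ψₙ⟩⟨ψₙ|` with a probability distribution `p` on a countable alphabet and unit
vectors `ψₙ` with the property `Q`. -/
def IsMixtureOf {X : Type} (Q : Hil X → Prop) (ρ : Op X X) : Prop :=
  ∃ (p : ℕ → ℝ) (ψ : ℕ → Hil X), (∀ n, 0 ≤ p n) ∧ HasSum p 1 ∧ (∀ n, ‖ψ n‖ = 1 ∧ Q (ψ n)) ∧
    HasSum (fun n => (p n : ℂ) • proj (ψ n)) ρ

/-- `ψ = ⨂ i, φ i` is a product vector with respect to the finest partition. -/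
def IsFullyProduct {ι : Type} [Fintype ι] {X : ι → Type} (ψ : Hil (∀ i, X i)) : Prop :=
  ∃ φ : ∀ i, Hil (X i), ∀ x, ψ x = ∏ i, φ i (x i)

/-- `ψ = a ⊗ b` is a product vector with respect to some partition of the parties into two
nonempty sets. -/
def IsBiproduct {ι : Type} {X : ι → Type} (ψ : Hil (∀ i, X i)) : Prop :=
  ∃ I : Set ι, I.Nonempty ∧ Iᶜ.Nonempty ∧
    ∃ (a : Hil (∀ i : I, X i)) (b : Hil (∀ i : ↥(Iᶜ), X i)),
      ∀ x, ψ x = a (fun i => x i) * b (fun i => x i)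

/-- The set `FS` of fully separable states. -/
def FS {ι : Type} [Fintype ι] (X : ι → Type) : Set (Op (∀ i, X i) (∀ i, X i)) :=
  {ρ | IsMixtureOf IsFullyProduct ρ}

/-- The set `BS` of biseparable states; the bipartition may vary from term to term. -/
def BS {ι : Type} (X : ι → Type) : Set (Op (∀ i, X i) (∀ i, X i)) :=
  {ρ | IsMixtureOf IsBiproduct ρ}

/-- The `ε`-hypothesis-testing relative entropy of genuine multipartite entanglement of a state. -/
def stateEhGE {ι : Type} {X : ι → Type} (ε : ℝ) (ρ : Op (∀ i, X i) (∀ i, X i)) : EReal :=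
  ⨅ σ ∈ BS X, hypothesisTestingDivergence ε ρ σ

/-! ### Channels and LOCC -/

/-- The operator-sum map `ρ ↦ ∑ₖ Vₖ ρ Vₖ†`. -/
def applyKraus {κ X Y : Type} (V : κ → Op X Y) (ρ : Op X X) : Op Y Y :=
  ∑' k, V k ∘L ρ ∘L ContinuousLinearMap.adjoint (V k)

/-- `∑ₖ Vₖ† Vₖ = 1`: the operator-sum map of `V` is completely positive and trace preserving. -/
def IsChannel {κ X Y : Type} (V : κ → Op X Y) : Prop :=
  ∀ v, HasSum (fun k => ‖V k v‖ ^ 2) (‖v‖ ^ 2)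

/-- `∑ₖ Vₖ† Vₖ ≤ 1`: the operator-sum map of `V` is completely positive and trace
non-increasing. -/
def IsTraceNonincreasing {κ X Y : Type} (V : κ → Op X Y) : Prop :=
  ∀ v (s : Finset κ), ∑ k ∈ s, ‖V k v‖ ^ 2 ≤ ‖v‖ ^ 2

/-- Kraus operators of `∑ₓ ⨂ᵢ ℰ^{i,x}`, where `E x i` is a Kraus family of `ℰ^{i,x}`. Finite
alphabets and finite Kraus families are padded with zeros. -/
def loccKraus {ι : Type} [Fintype ι] {X Y : ι → Type} (E : ℕ → ∀ i, ℕ → Op (X i) (Y i)) :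
    ℕ × (ι → ℕ) → Op (∀ i, X i) (∀ i, Y i) :=
  fun p => tensorOp fun i => E p.1 i (p.2 i)

/-- `∑ₓ ⨂ᵢ ℰ^{i,x}` is an LOCC channel: every `ℰ^{i,x}` is completely positive and trace
non-increasing, and the sum is a channel. -/
def IsLOCC {ι : Type} [Fintype ι] {X Y : ι → Type} (E : ℕ → ∀ i, ℕ → Op (X i) (Y i)) : Prop :=
  (∀ x i, IsTraceNonincreasing (E x i)) ∧ IsChannel (loccKraus E)

/-! ### Private states -/

section PrivateStates

variable {ι : Type} {K : ℕ} {S : ι → Type}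

theorem keyKet_aux (k : ι → Fin K) :
    Function.Injective fun (s : ∀ i, S i) (i : ι) => ((k i, s i) : Fin K × S i) := by
  intro s t h
  funext i
  exact congrArg Prod.snd (congrFun h i)

open Classical in
/-- The isometry `|k⟩_K ⊗ 1_S`, where party `i` holds the key system with basis `Fin K` and the
shield system with basis `S i`. -/
def keyKet (k : ι → Fin K) : Op (∀ i, S i) (∀ i, Fin K × S i) :=
  opOfMatrix fun z s => if z = fun i => (k i, s i) then 1 else 0

open Classical in
theorem entry_keyKet (k : ι → Fin K) (z : ∀ i, Fin K × S i) (s : ∀ i, S i) :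
    entry (keyKet k) z s = if z = fun i => (k i, s i) then 1 else 0 :=
  entry_opOfMatrix (m := fun (z : ∀ i, Fin K × S i) (s : ∀ i, S i) =>
    if z = fun i => (k i, s i) then (1 : ℂ) else 0) (exists_push _ (keyKet_aux k)) z s

/-- `Φ^GHZ ⊗ ω = (1/K) ∑_{k,l} |k…k⟩⟨l…l| ⊗ ω`. -/
def ghzTensor (ω : Op (∀ i, S i) (∀ i, S i)) : Op (∀ i, Fin K × S i) (∀ i, Fin K × S i) :=
  (1 / (K : ℂ)) • ∑ k : Fin K, ∑ l : Fin K,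
    keyKet (fun _ => k) ∘L ω ∘L ContinuousLinearMap.adjoint (keyKet fun _ => l)

open Classical in
/-- The twisting unitary `∑_k |k⟩⟨k| ⊗ U^k`, over all tuples `k` of key values. -/
def twisting [Fintype ι] (U : (ι → Fin K) → Op (∀ i, S i) (∀ i, S i)) :
    Op (∀ i, Fin K × S i) (∀ i, Fin K × S i) :=
  ∑ k : ι → Fin K, keyKet k ∘L U k ∘L ContinuousLinearMap.adjoint (keyKet k)

/-- `γ` is a private state: `γ = U (Φ^GHZ ⊗ ω) U†` for a twisting unitary `U` and a density
operator `ω` of the shield systems. -/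
def IsPrivateState [Fintype ι] (γ : Op (∀ i, Fin K × S i) (∀ i, Fin K × S i)) : Prop :=
  ∃ (U : (ι → Fin K) → Op (∀ i, S i) (∀ i, S i)) (ω : Op (∀ i, S i) (∀ i, S i)),
    (∀ k, U k ∈ unitary (Op (∀ i, S i) (∀ i, S i))) ∧ IsDensity ω ∧
      γ = twisting U ∘L ghzTensor ω ∘L ContinuousLinearMap.adjoint (twisting U)

end PrivateStates

/-! ### Multiplex channels -/

section Multiplex

variable {α β γ κ : Type}

/-- A Kraus family of a multiplex channel from the systems `A' a`, `B b` to the systems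
`A a`, `C c`. Parties `a : α` send and receive, `b : β` only send, `c : γ` only receive. -/
abbrev MultiplexKraus (κ : Type) (A' : α → Type) (B : β → Type) (A : α → Type) (C : γ → Type) :
    Type :=
  κ → Op ((∀ a, A' a) × (∀ b, B b)) ((∀ a, A a) × (∀ c, C c))

/-- The systems held by the parties before the use of the channel: `L_a A'_a`, `R_b B_b`, `P_c`. -/
def SysIn (L A' : α → Type) (R B : β → Type) (P : γ → Type) : α ⊕ β ⊕ γ → Type
  | .inl a => L a × A' a
  | .inr (.inl b) => R b × B b
  | .inr (.inr c) => P c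

/-- The systems held by the parties after the use of the channel: `L_a A_a`, `R_b`, `P_c C_c`. -/
def SysOut (L A : α → Type) (R : β → Type) (P C : γ → Type) : α ⊕ β ⊕ γ → Type
  | .inl a => L a × A a
  | .inr (.inl b) => R b
  | .inr (.inr c) => P c × C c

/-- Sorting the input systems into reference systems and channel inputs. -/
def splitIn (L A' : α → Type) (R B : β → Type) (P : γ → Type) :
    (∀ i, SysIn L A' R B P i) ≃
      ((∀ a, L a) × (∀ b, R b) × (∀ c, P c)) × ((∀ a, A' a) × (∀ b, B b)) where
  toFun x := ((fun a => (x (.inl a)).1, fun b => (x (.inr (.inl b))).1, fun c => x (.inr (.inr c))),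
    (fun a => (x (.inl a)).2, fun b => (x (.inr (.inl b))).2))
  invFun z
    | .inl a => (z.1.1 a, z.2.1 a)
    | .inr (.inl b) => (z.1.2.1 b, z.2.2 b)
    | .inr (.inr c) => z.1.2.2 c
  left_inv x := by
    funext i
    rcases i with a | b | c <;> rfl
  right_inv _ := rfl

/-- Sorting the output systems into reference systems and channel outputs. -/
def splitOut (L A : α → Type) (R : β → Type) (P C : γ → Type) :
    (∀ i, SysOut L A R P C i) ≃
      ((∀ a, L a) × (∀ b, R b) × (∀ c, P c)) × ((∀ a, A a) × (∀ c, C c)) where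
  toFun x := ((fun a => (x (.inl a)).1, fun b => x (.inr (.inl b)), fun c => (x (.inr (.inr c))).1),
    (fun a => (x (.inl a)).2, fun c => (x (.inr (.inr c))).2))
  invFun z
    | .inl a => (z.1.1 a, z.2.1 a)
    | .inr (.inl b) => z.1.2.1 b
    | .inr (.inr c) => (z.1.2.2 c, z.2.2 c)
  left_inv x := by
    funext i
    rcases i with a | b | c <;> rfl
  right_inv _ := rfl

open Classical in
/-- Kraus operators of `id_{LRP} ⊗ N`: the channel acts on the channel inputs, and the reference
systems are left alone. -/
def withReferences {A' : α → Type} {B : β → Type} {A : α → Type} {C : γ → Type}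
    (N : MultiplexKraus κ A' B A C) (L : α → Type) (R : β → Type) (P : γ → Type) :
    κ → Op (∀ i, SysIn L A' R B P i) (∀ i, SysOut L A R P C i) :=
  fun k => opOfMatrix fun y x =>
    if (splitOut L A R P C y).1 = (splitIn L A' R B P x).1 then
      entry (N k) (splitOut L A R P C y).2 (splitIn L A' R B P x).2 else 0

open Classical in
theorem entry_withReferences {A' : α → Type} {B : β → Type} {A : α → Type} {C : γ → Type}
    (N : MultiplexKraus κ A' B A C) (L : α → Type) (R : β → Type) (P : γ → Type) (k : κ)
    (y : ∀ i, SysOut L A R P C i) (x : ∀ i, SysIn L A' R B P i) :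
    entry (withReferences N L R P k) y x =
      if (splitOut L A R P C y).1 = (splitIn L A' R B P x).1 then
        entry (N k) (splitOut L A R P C y).2 (splitIn L A' R B P x).2 else 0 := by
  refine entry_opOfMatrix ?_ y x
  obtain ⟨S, hS⟩ := exists_ampliation ((∀ a, L a) × (∀ b, R b) × (∀ c, P c)) (N k)
  obtain ⟨T, hT⟩ := exists_reindex S (splitIn L A' R B P) (splitOut L A R P C)
  exact ⟨T, fun y x => by rw [hT, hS]; split_ifs <;> rfl⟩

/-- Kraus operators of `N^{⊗n}`, a multiplex channel between the `n`-fold systems. -/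
def tensorPower {A' : α → Type} {B : β → Type} {A : α → Type} {C : γ → Type}
    (N : MultiplexKraus κ A' B A C) (n : ℕ) :
    MultiplexKraus (Fin n → κ) (fun a => Fin n → A' a) (fun b => Fin n → B b)
      (fun a => Fin n → A a) (fun c => Fin n → C c) :=
  fun k => opOfMatrix fun y x => ∏ t : Fin n,
    entry (N (k t)) (fun a => y.1 a t, fun c => y.2 c t) (fun a => x.1 a t, fun b => x.2 b t)

/-- Sorting an `n`-fold system by the channel uses. -/
def splitPower {δ δ' : Type} (U : δ → Type) (V : δ' → Type) (n : ℕ) :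
    ((∀ a, Fin n → U a) × (∀ b, Fin n → V b)) ≃ (Fin n → (∀ a, U a) × (∀ b, V b)) where
  toFun x t := (fun a => x.1 a t, fun b => x.2 b t)
  invFun z := (fun a t => (z t).1 a, fun b t => (z t).2 b)
  left_inv _ := rfl
  right_inv _ := rfl

theorem entry_tensorPower {A' : α → Type} {B : β → Type} {A : α → Type} {C : γ → Type}
    (N : MultiplexKraus κ A' B A C) (n : ℕ) (k : Fin n → κ)
    (y : (∀ a, Fin n → A a) × (∀ c, Fin n → C c)) (x : (∀ a, Fin n → A' a) × (∀ b, Fin n → B b)) :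
    entry (tensorPower N n k) y x = ∏ t : Fin n,
      entry (N (k t)) (fun a => y.1 a t, fun c => y.2 c t) (fun a => x.1 a t, fun b => x.2 b t) := by
  refine entry_opOfMatrix ?_ y x
  obtain ⟨S, hS⟩ := exists_tensor fun t => N (k t)
  obtain ⟨T, hT⟩ := exists_reindex S (splitPower A' B n) (splitPower A C n)
  exact ⟨T, fun y x => by rw [hT, hS]; rfl⟩

variable [Fintype α] [Fintype β] [Fintype γ]

/-- The `ε`-hypothesis-testing relative entropy of genuine multipartite entanglement of the
multiplex channel `N`: the supremum over all reference systems `L_a`, `R_b` and all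
`ψ ∈ FS(:LA':RB:)` of `stateEhGE` of the output state on `:LA:R:C:`. The parties `c : γ` have a
one-dimensional reference system, that is, none. -/
def channelEhGE {A' : α → Type} {B : β → Type} {A : α → Type} {C : γ → Type}
    (N : MultiplexKraus κ A' B A C) (ε : ℝ) : EReal :=
  sSup {e : EReal | ∃ (L : α → Type) (R : β → Type),
    (∀ a, Countable (L a)) ∧ (∀ b, Countable (R b)) ∧
    ∃ ψ ∈ FS (SysIn L A' R B fun _ : γ => Unit),
      e = stateEhGE ε (applyKraus (withReferences N L R fun _ => Unit) ψ)}

/-- The same supremum, restricted to pure input states. -/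
def pureChannelEhGE {A' : α → Type} {B : β → Type} {A : α → Type} {C : γ → Type}
    (N : MultiplexKraus κ A' B A C) (ε : ℝ) : EReal :=
  sSup {e : EReal | ∃ (L : α → Type) (R : β → Type),
    (∀ a, Countable (L a)) ∧ (∀ b, Countable (R b)) ∧
    ∃ ψ ∈ FS (SysIn L A' R B fun _ : γ => Unit), IsPure ψ ∧
      e = stateEhGE ε (applyKraus (withReferences N L R fun _ => Unit) ψ)}

/-! ### Conference key agreement -/

/-- There is a cppp-assisted protocol with key size `K` and error `ε` over one use of `N`. The first
LOCC prepares a fully separable state `ρ` of `:LA':RB:P:`; after the use of the channel, an LOCC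
channel among all parties produces a state of key and shield systems that has fidelity at least
`1 - ε` with a private state. -/
def IsOneUseProtocol {A' : α → Type} {B : β → Type} {A : α → Type} {C : γ → Type}
    (N : MultiplexKraus κ A' B A C) (K : ℕ) (ε : ℝ) : Prop :=
  0 < K ∧
  ∃ (L : α → Type) (R : β → Type) (P : γ → Type) (S : α ⊕ β ⊕ γ → Type),
    (∀ a, Countable (L a)) ∧ (∀ b, Countable (R b)) ∧ (∀ c, Countable (P c)) ∧
    (∀ i, Countable (S i)) ∧
    ∃ ρ ∈ FS (SysIn L A' R B P),
    ∃ D : ℕ → ∀ i, ℕ → Op (SysOut L A R P C i) (Fin K × S i), IsLOCC D ∧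
    ∃ priv : Op (∀ i, Fin K × S i) (∀ i, Fin K × S i), IsPrivateState priv ∧
      1 - ε ≤ fidelity priv (applyKraus (loccKraus D) (applyKraus (withReferences N L R P) ρ))

/-- The one-shot key rate: the supremum of `log₂ K` over all one-use protocols with error `ε`. -/
def oneShotRate {A' : α → Type} {B : β → Type} {A : α → Type} {C : γ → Type}
    (N : MultiplexKraus κ A' B A C) (ε : ℝ) : EReal :=
  sSup {r : EReal | ∃ K : ℕ, IsOneUseProtocol N K ε ∧ r = (Real.logb 2 K : ℝ)}

/-- The key rate of `n` uses: the supremum of `(1/n) log₂ K` over all `(n, K, ε)` cppp-assisted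
protocols over `N`, that is, one-use protocols over `N^{⊗n}`. -/
def nShotRate {A' : α → Type} {B : β → Type} {A : α → Type} {C : γ → Type}
    (N : MultiplexKraus κ A' B A C) (n : ℕ) (ε : ℝ) : EReal :=
  sSup {r : EReal | ∃ K : ℕ, IsOneUseProtocol (tensorPower N n) K ε ∧
    r = (1 / (n : ℝ) * Real.logb 2 K : ℝ)}

end Multiplex

end CKA

end

open scoped lp

noncomputable section

namespace CKA

section

variable {X Y Z : Type}

theorem inner_ket_left (x : X) (v : Hil X) : inner ℂ (ket x) v = v x := by
  classical
  unfold ket; rw [lp.inner_single_left]; simp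

theorem inner_ket_right (x : X) (v : Hil X) : inner ℂ v (ket x) = star (v x) := by
  rw [← inner_conj_symm, inner_ket_left]; rfl

theorem norm_ket (x : X) : ‖ket x‖ = 1 := by
  classical
  unfold ket
  rw [lp.norm_single (by norm_num)]; simp

theorem entry_eq_inner (T : Op X Y) (y : Y) (x : X) :
    entry T y x = inner ℂ (ket y) (T (ket x)) := (inner_ket_left _ _).symm

theorem entry_adjoint (T : Op X Y) (x : X) (y : Y) :
    entry (ContinuousLinearMap.adjoint T) x y = star (entry T y x) := by
  rw [entry_eq_inner, ContinuousLinearMap.adjoint_inner_right, inner_ket_right]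
  rfl

theorem hasSum_apply (S : Op X Y) (f : Hil X) (y : Y) :
    HasSum (fun x => f x * entry S y x) (S f y) := by
  classical
  have h1 := (lp.hasSum_single (p := 2) (by norm_num) f).mapL S
  have h3 := h1.mapL (lp.evalCLM ℂ (fun _ : Y => ℂ) 2 y)
  refine Eq.mp (congrArg (fun u => HasSum u _) (funext fun x => ?_)) h3
  have e : ∀ c : ℂ, (lp.single 2 x c : Hil X) = c • ket x := by
    intro c
    unfold ket
    rw [← lp.single_smul]; simp
  simp only [e, map_smul, smul_eq_mul]
  rfl

theorem hasSum_inner (u v : Hil X) : HasSum (fun x => star (u x) * v x) (inner ℂ u v) := by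
  refine (lp.hasSum_inner u v).congr_fun fun x => ?_
  simp [mul_comm]

theorem hasSum_norm_sq_adjoint {T : Op X Y} {s : ℝ}
    (h : HasSum (fun x => ‖T (ket x)‖ ^ 2) s) :
    HasSum (fun y => ‖ContinuousLinearMap.adjoint T (ket y)‖ ^ 2) s := by
  have h1 : Summable fun p : X × Y => ‖T (ket p.1) p.2‖ ^ 2 := by
    rw [summable_prod_of_nonneg (fun _ => by positivity)]
    refine ⟨fun x => (hasSum_norm_sq (T (ket x))).summable, ?_⟩
    simpa only [(hasSum_norm_sq _).tsum_eq] using h.summable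
  have h2 := h1.hasSum
  have e : ∑' p : X × Y, ‖T (ket p.1) p.2‖ ^ 2 = s :=
    (h2.prod_fiberwise fun x => hasSum_norm_sq (T (ket x))).unique h
  rw [e] at h2
  have h3 := (Equiv.prodComm Y X).hasSum_iff.2 h2
  refine h3.prod_fiberwise fun y => ?_
  refine Eq.mp (congrArg (fun u => HasSum u _) (funext fun x => ?_))
    (hasSum_norm_sq (ContinuousLinearMap.adjoint T (ket y)))
  have := entry_adjoint T x y
  unfold entry at this
  rw [this, norm_star]
  rfl

theorem norm_pull_equiv (e : X ≃ Y) (f : Hil Y) : ‖pull e e.injective f‖ = ‖f‖ := by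
  have h1 := hasSum_norm_sq (pull e e.injective f)
  have h2 : HasSum (fun x => ‖f (e x)‖ ^ 2) (‖f‖ ^ 2) := e.hasSum_iff.2 (hasSum_norm_sq f)
  exact (sq_eq_sq₀ (norm_nonneg _) (norm_nonneg _)).1 (h1.unique h2)

theorem pull_apply (g : X → Y) (hg : Function.Injective g) (f : Hil Y) (x : X) :
    pull g hg f x = f (g x) := rfl

theorem norm_pull_le (g : X → Y) (hg : Function.Injective g) (f : Hil Y) :
    ‖pull g hg f‖ ≤ ‖f‖ := by
  refine le_of_sq_le_sq ?_ (norm_nonneg _)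
  rw [← (hasSum_norm_sq f).tsum_eq, ← (hasSum_norm_sq _).tsum_eq]
  exact tsum_comp_le_tsum_of_inj (hasSum_norm_sq f).summable (fun _ => by positivity) hg

/-! ### Ensembles of vectors -/

/-- `ρ = ∑ⱼ |vⱼ⟩⟨vⱼ|` with `∑ⱼ ‖vⱼ‖² = t`. -/
structure IsEnsemble {J : Type} (v : J → Hil X) (t : ℝ) (ρ : Op X X) : Prop where
  norm_sq : HasSum (fun j => ‖v j‖ ^ 2) t
  sum : HasSum (fun j => proj (v j)) ρ

theorem norm_proj (v : Hil X) : ‖proj v‖ = ‖v‖ ^ 2 := by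
  unfold proj
  rw [InnerProductSpace.norm_rankOne, sq]

theorem proj_smul (c : ℂ) (v : Hil X) : proj (c • v) = (‖c‖ ^ 2 : ℂ) • proj v := by
  ext1 w
  simp only [proj, InnerProductSpace.rankOne_apply, smul_apply, inner_smul_left,
    smul_smul]
  congr 1
  rw [mul_assoc, mul_comm (inner ℂ v w) c, ← mul_assoc, mul_comm _ c, Complex.mul_conj,
    Complex.normSq_eq_norm_sq]
  simp

theorem comp_proj_comp (V : Op X Y) (v : Hil X) :
    V ∘L proj v ∘L ContinuousLinearMap.adjoint V = proj (V v) := by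
  ext1 w
  simp [proj, InnerProductSpace.rankOne_apply, ContinuousLinearMap.adjoint_inner_right]

theorem isEnsemble_proj (v : Hil X) : IsEnsemble (fun _ : Unit => v) (‖v‖ ^ 2) (proj v) :=
  ⟨hasSum_unique _, hasSum_unique _⟩

theorem IsMixtureOf.isEnsemble {Q : Hil X → Prop} {ρ : Op X X} {p : ℕ → ℝ} {ψ : ℕ → Hil X}
    (hp : ∀ n, 0 ≤ p n) (h1 : HasSum p 1) (hψ : ∀ n, ‖ψ n‖ = 1 ∧ Q (ψ n))
    (h : HasSum (fun n => (p n : ℂ) • proj (ψ n)) ρ) :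
    IsEnsemble (fun n => ((Real.sqrt (p n) : ℝ) : ℂ) • ψ n) 1 ρ := by
  constructor
  · refine Eq.mp (congrArg (fun u => HasSum u _) (funext fun n => ?_)) h1
    rw [norm_smul, (hψ n).1, mul_one, Complex.norm_real, Real.norm_eq_abs, sq_abs,
      Real.sq_sqrt (hp n)]
  · refine Eq.mp (congrArg (fun u => HasSum u _) (funext fun n => ?_)) h
    rw [proj_smul, Complex.norm_real, Real.norm_eq_abs]
    congr 1
    rw [← Complex.ofReal_pow, sq_abs, Real.sq_sqrt (hp n)]

/-- The outcome probability `⟨v|Λ|v⟩` is summed over an ensemble by the trace. -/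
theorem IsEnsemble.hasSum_trace {J : Type} {v : J → Hil X} {t : ℝ} {ρ : Op X X}
    (h : IsEnsemble v t ρ) (Λ : Op X X) :
    Summable (fun j => inner ℂ (v j) (Λ (v j))) ∧
    HasSum (fun x => entry (Λ ∘L ρ) x x) (∑' j, inner ℂ (v j) (Λ (v j))) := by
  have key : ∀ j x, entry (Λ ∘L proj (v j)) x x = star (v j x) * Λ (v j) x := by
    intro j x
    simp only [entry, proj, ContinuousLinearMap.comp_apply, InnerProductSpace.rankOne_apply,
      inner_ket_right, map_smul]
    rfl
  have hfib : ∀ j, HasSum (fun x => entry (Λ ∘L proj (v j)) x x) (inner ℂ (v j) (Λ (v j))) := by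
    intro j
    simp only [key]
    exact hasSum_inner _ _
  have hbd : ∀ j, Summable (fun x => ‖star (v j x) * Λ (v j) x‖) ∧
      ∑' x, ‖star (v j x) * Λ (v j) x‖ ≤ ‖Λ‖ * ‖v j‖ ^ 2 := by
    intro j
    have h1 := (hasSum_norm_sq (v j))
    have h2 := (hasSum_norm_sq (Λ (v j)))
    have := Real.inner_le_Lp_mul_Lq_tsum_of_nonneg (f := fun x => ‖v j x‖)
      (g := fun x => ‖Λ (v j) x‖) Real.HolderConjugate.two_two (fun _ => norm_nonneg _)
      (fun _ => norm_nonneg _) (by simpa using h1.summable) (by simpa using h2.summable)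
    simp only [norm_mul, norm_star]
    refine ⟨by simpa using (hasSum_inner (v j) (Λ (v j))).summable.norm, this.trans ?_⟩
    simp only [Real.rpow_two, h1.tsum_eq, h2.tsum_eq]
    rw [← Real.sqrt_eq_rpow, ← Real.sqrt_eq_rpow, Real.sqrt_sq (norm_nonneg _),
      Real.sqrt_sq (norm_nonneg _)]
    have := Λ.le_opNorm (v j)
    nlinarith [norm_nonneg (v j)]
  have hsum : Summable fun q : J × X => entry (Λ ∘L proj (v q.1)) q.2 q.2 := by
    apply Summable.of_norm
    simp only [key]
    rw [summable_prod_of_nonneg (fun _ => by positivity)]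
    exact ⟨fun j => (hbd j).1, Summable.of_nonneg_of_le (fun j => tsum_nonneg fun _ => norm_nonneg _)
      (fun j => (hbd j).2) (h.norm_sq.summable.mul_left _)⟩
  have h1 := hsum.hasSum
  have h2 := h1.prod_fiberwise hfib
  refine ⟨h2.summable, ?_⟩
  rw [h2.tsum_eq]
  refine ((Equiv.prodComm X J).hasSum_iff.2 h1).prod_fiberwise fun x => ?_
  let ev : Op X X →L[ℂ] ℂ :=
    (lp.evalCLM ℂ (fun _ : X => ℂ) 2 x).comp ((ContinuousLinearMap.apply ℂ (Hil X) (ket x)).comp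
      (ContinuousLinearMap.compL ℂ (Hil X) (Hil X) (Hil X) Λ))
  exact h.sum.mapL ev

theorem IsEnsemble.tr_eq {J : Type} {v : J → Hil X} {t : ℝ} {ρ : Op X X}
    (h : IsEnsemble v t ρ) (Λ : Op X X) :
    HasSum (fun j => (inner ℂ (v j) (Λ (v j))).re) (tr (Λ ∘L ρ)).re := by
  obtain ⟨h1, h2⟩ := h.hasSum_trace Λ
  unfold tr
  rw [h2.tsum_eq]
  exact Complex.hasSum_re h1.hasSum

theorem IsEnsemble.isPositive {J : Type} {v : J → Hil X} {t : ℝ} {ρ : Op X X}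
    (h : IsEnsemble v t ρ) : 0 ≤ ρ := by
  refine h.sum.nonneg fun j => ?_
  rw [ContinuousLinearMap.nonneg_iff_isPositive]
  exact InnerProductSpace.isPositive_rankOne_self _

theorem IsEnsemble.hasSum_inner {J : Type} {v : J → Hil X} {t : ℝ} {ρ : Op X X}
    (h : IsEnsemble v t ρ) (w : Hil X) :
    HasSum (fun j => ‖inner ℂ w (v j)‖ ^ 2) (inner ℂ w (ρ w)).re := by
  have h1 := (h.sum.mapL (ContinuousLinearMap.apply ℂ (Hil X) w)).mapL (innerSL ℂ w)
  have h2 := Complex.hasSum_re h1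
  refine Eq.mp (congrArg (fun u => HasSum u _) (funext fun j => ?_)) h2
  simp only [proj, ContinuousLinearMap.apply_apply, InnerProductSpace.rankOne_apply, map_smul,
    innerSL_apply_apply, smul_eq_mul]
  rw [← inner_conj_symm, mul_comm, Complex.mul_conj, Complex.normSq_eq_norm_sq, Complex.ofReal_re]

theorem summable_norm_sq_kraus {κ J : Type} {V : κ → Op X Y} (hV : IsChannel V) {v : J → Hil X}
    {t : ℝ} (h : HasSum (fun j => ‖v j‖ ^ 2) t) :
    HasSum (fun q : κ × J => ‖V q.1 (v q.2)‖ ^ 2) t := by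
  have h1 : Summable fun q : J × κ => ‖V q.2 (v q.1)‖ ^ 2 := by
    rw [summable_prod_of_nonneg (fun _ => by positivity)]
    refine ⟨fun j => (hV (v j)).summable, ?_⟩
    simpa only [(hV _).tsum_eq] using h.summable
  have h2 := h1.hasSum
  rw [(h2.prod_fiberwise fun j => hV (v j)).unique h] at h2
  exact (Equiv.prodComm κ J).hasSum_iff.2 h2

theorem IsEnsemble.applyKraus {κ J : Type} {V : κ → Op X Y} (hV : IsChannel V) {v : J → Hil X}
    {t : ℝ} {ρ : Op X X} (h : IsEnsemble v t ρ) :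
    IsEnsemble (fun q : κ × J => V q.1 (v q.2)) t (applyKraus V ρ) := by
  have hn := summable_norm_sq_kraus hV h.norm_sq
  refine ⟨hn, ?_⟩
  have hs : Summable fun q : κ × J => proj (V q.1 (v q.2)) := by
    apply Summable.of_norm
    simpa only [norm_proj] using hn.summable
  have hf : ∀ k, HasSum (fun j => proj (V k (v j)))
      (V k ∘L ρ ∘L ContinuousLinearMap.adjoint (V k)) := by
    intro k
    have := (h.sum.mapL ((ContinuousLinearMap.compL ℂ (Hil Y) (Hil X) (Hil X)).flip
      (ContinuousLinearMap.adjoint (V k)))).mapL (ContinuousLinearMap.compL ℂ (Hil Y) (Hil X) (Hil Y) (V k))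
    refine Eq.mp (congrArg (fun u => HasSum u _) (funext fun j => ?_)) this
    exact comp_proj_comp _ _
  unfold CKA.applyKraus
  rw [(hs.hasSum.prod_fiberwise hf).tsum_eq]
  exact hs.hasSum

/-- The measurement outcome described by a trace non-increasing Kraus family. -/
theorem exists_test {κ : Type} {T : κ → Op X Y} (hT : IsTraceNonincreasing T) :
    ∃ Λ : Op X X, 0 ≤ Λ ∧ Λ ≤ 1 ∧ ∀ v, HasSum (fun k => ‖T k v‖ ^ 2) (inner ℂ v (Λ v)).re := by
  have hs : ∀ v, Summable fun k => ‖T k v‖ ^ 2 := fun v =>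
    summable_of_sum_le (fun _ => by positivity) (hT v)
  have hp : ∀ v, Summable fun p : κ × Y => ‖T p.1 v p.2‖ ^ 2 := by
    intro v
    rw [summable_prod_of_nonneg (fun _ => by positivity)]
    refine ⟨fun k => (hasSum_norm_sq (T k v)).summable, ?_⟩
    simpa only [(hasSum_norm_sq _).tsum_eq] using hs v
  let L : Hil X →ₗ[ℂ] Hil (κ × Y) :=
    { toFun := fun f => ⟨fun p => T p.1 f p.2, memlp_two (hp f)⟩
      map_add' := fun f g => by ext p; simp only [map_add]; rfl
      map_smul' := fun c f => by ext p; simp only [map_smul]; rfl }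
  have hL : ∀ v, HasSum (fun k => ‖T k v‖ ^ 2) (‖L v‖ ^ 2) := fun v =>
    (hasSum_norm_sq (L v)).prod_fiberwise fun k => hasSum_norm_sq (T k v)
  have hle : ∀ v, ‖L v‖ ≤ 1 * ‖v‖ := by
    intro v
    rw [one_mul]
    exact le_of_sq_le_sq (hasSum_le_of_sum_le (hL v) (hT v)) (norm_nonneg _)
  let B : Op X (κ × Y) := L.mkContinuous 1 hle
  have hB : ∀ v, (inner ℂ v ((ContinuousLinearMap.adjoint B ∘L B) v)) = ((‖L v‖ ^ 2 : ℝ) : ℂ) := by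
    intro v
    rw [ContinuousLinearMap.comp_apply, ContinuousLinearMap.adjoint_inner_right,
      inner_self_eq_norm_sq_to_K]
    simp; rfl
  refine ⟨ContinuousLinearMap.adjoint B ∘L B, ?_, ?_, fun v => ?_⟩
  · rw [ContinuousLinearMap.nonneg_iff_isPositive]
    exact ContinuousLinearMap.isPositive_adjoint_comp_self B
  · rw [ContinuousLinearMap.le_def, ContinuousLinearMap.isPositive_iff_complex]
    intro v
    have : inner ℂ ((1 - ContinuousLinearMap.adjoint B ∘L B : Op X X) v) v
        = ((‖v‖ ^ 2 - ‖L v‖ ^ 2 : ℝ) : ℂ) := by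
      rw [← inner_conj_symm, sub_apply, inner_sub_right, hB]
      simp [inner_self_eq_norm_sq_to_K]
    rw [this]
    rw [RCLike.re_to_complex, Complex.ofReal_re]
    refine ⟨rfl, ?_⟩
    have := hle v
    rw [one_mul] at this
    nlinarith [norm_nonneg (L v), norm_nonneg v]
  · rw [hB]; exact hL v

end

section

variable {X Y Z X' Y' : Type}

/-! ### Tensor products of channels -/

open Classical in
theorem ampliation_apply {T : Op X Y} {S : Op (Z × X) (Z × Y)}
    (hS : ∀ y x, entry S y x = if y.1 = x.1 then entry T y.2 x.2 else 0)
    (f : Hil (Z × X)) (z : Z) (y : Y) :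
    S f (z, y) = T (pull (fun x : X => (z, x)) (Prod.mk_right_injective z) f) y := by
  have h := hasSum_apply S f (z, y)
  have hi := Prod.mk_right_injective (β := X) z
  rw [← hi.hasSum_iff] at h
  · refine h.unique ?_
    refine Eq.mp (congrArg (fun u => HasSum u _) (funext fun x => ?_))
      (hasSum_apply T (pull (fun x : X => (z, x)) hi f) y)
    simp [hS, pull_apply]
  · rintro ⟨z', x⟩ hx
    have : z ≠ z' := fun hz => hx ⟨x, by rw [hz]⟩
    simp [hS, this]

open Classical in
theorem IsChannel.ampliation {κ : Type} {T : κ → Op X Y} (hT : IsChannel T)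
    {S : κ → Op (Z × X) (Z × Y)}
    (hS : ∀ k y x, entry (S k) y x = if y.1 = x.1 then entry (T k) y.2 x.2 else 0) :
    IsChannel S := by
  intro f
  have hf : HasSum (fun z => ‖pull (fun x : X => (z, x)) (Prod.mk_right_injective z) f‖ ^ 2)
      (‖f‖ ^ 2) :=
    (hasSum_norm_sq f).prod_fiberwise fun z => hasSum_norm_sq
      (pull (fun x : X => (z, x)) (Prod.mk_right_injective z) f)
  refine (summable_norm_sq_kraus hT hf).prod_fiberwise fun k => ?_
  refine HasSum.prod_fiberwise (hasSum_norm_sq (S k f)) fun z => ?_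
  simp only [ampliation_apply (hS k)]
  exact hasSum_norm_sq _

theorem IsChannel.reindex {κ κ' : Type} {T : κ → Op X Y} (hT : IsChannel T) (eκ : κ' ≃ κ)
    (eX : X' ≃ X) (eY : Y' ≃ Y) {S : κ' → Op X' Y'}
    (hS : ∀ k y x, entry (S k) y x = entry (T (eκ k)) (eY y) (eX x)) : IsChannel S := by
  have h : ∀ k, S k = (pull eY eY.injective).comp
      ((T (eκ k)).comp (pull eX.symm eX.symm.injective)) := by
    intro k
    apply op_ext
    intro y x
    rw [hS]
    have : pull eX.symm eX.symm.injective (ket x) = ket (eX x) := by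
      ext z
      rw [pull_apply, ket_apply, ket_apply]
      by_cases h : z = eX x
      · simp [h]
      · simp [h, Equiv.symm_apply_eq]
    simp only [entry, ContinuousLinearMap.comp_apply, this]
    rfl
  intro v
  simp only [h, ContinuousLinearMap.comp_apply, norm_pull_equiv]
  have := hT (pull eX.symm eX.symm.injective v)
  rw [norm_pull_equiv] at this
  exact eκ.hasSum_iff.2 this

theorem IsChannel.comp {κ μ : Type} {V : κ → Op Y Z} {W : μ → Op X Y} (hV : IsChannel V)
    (hW : IsChannel W) : IsChannel fun q : κ × μ => V q.1 ∘L W q.2 := by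
  intro v
  have h := summable_norm_sq_kraus hV (hW v)
  exact h

theorem IsChannel.tensorTwo {κ μ : Type} {V : κ → Op X Y} {W : μ → Op X' Y'} (hV : IsChannel V)
    (hW : IsChannel W) {S : κ × μ → Op (X × X') (Y × Y')}
    (hS : ∀ q y x, entry (S q) y x = entry (V q.1) y.1 x.1 * entry (W q.2) y.2 x.2) :
    IsChannel S := by
  classical
  choose S1 h1 using fun k => exists_ampliation X' (V k)
  choose S2 h2 using fun l => exists_ampliation Y (W l)
  choose S1' h1' using fun k => exists_reindex (S1 k) (Equiv.prodComm X X') (Equiv.prodComm Y X')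
  have c1 : IsChannel S1 := hV.ampliation fun k y x => h1 k y x
  have c2 : IsChannel S2 := hW.ampliation fun k y x => h2 k y x
  have c1' : IsChannel S1' := c1.reindex (Equiv.refl _) _ _ h1'
  have c := (c2.comp c1').reindex (Equiv.prodComm κ μ) (Equiv.refl _) (Equiv.refl _) (S := S) ?_
  · exact c
  · intro q y x
    simp only [Equiv.prodComm_apply, Equiv.refl_apply, Prod.fst_swap, Prod.snd_swap]
    rw [hS, apply_eq_of_comp (S2 q.2) (S1' q.1) y x (y.1, x.2)]
    · simp [h1', h1, h2]
    · intro p hp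
      simp only [h1', h1, h2, Equiv.prodComm_apply, Prod.fst_swap, Prod.snd_swap]
      by_cases ha : p.2 = x.2
      · have : y.1 ≠ p.1 := fun hb => hp (Prod.ext hb.symm ha)
        simp [this]
      · simp [ha]

theorem isChannel_tensor_fin : ∀ (n : ℕ) (κ X Y : Fin n → Type)
    (T : ∀ i, κ i → Op (X i) (Y i)) (_ : ∀ i, IsChannel (T i)),
    IsChannel fun k : ∀ i, κ i => tensorOp fun i => T i (k i)
  | 0, κ, X, Y, T, _ => by
    intro v
    have : tensorOp (fun i => T i ((default : ∀ i, κ i) i))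
        = pull (Equiv.ofUnique (∀ i, Y i) (∀ i, X i)) (Equiv.injective _) := by
      apply op_ext
      intro y x
      rw [entry_tensorOp]
      simp only [entry, pull_apply, ket_apply]
      simp [Subsingleton.elim _ x]
    refine Eq.mp (congrArg (fun u => HasSum _ u) ?_) (hasSum_unique _)
    change ‖(tensorOp fun i => T i ((default : ∀ i, κ i) i)) v‖ ^ 2 = _
    rw [this, norm_pull_equiv]
  | n + 1, κ, X, Y, T, hT => by
    have ih := isChannel_tensor_fin n (fun i => κ i.succ) (fun i => X i.succ) (fun i => Y i.succ)
      (fun i => T i.succ) fun i => hT i.succ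
    choose S hS using fun q : κ 0 × (∀ i : Fin n, κ i.succ) =>
      exists_tensor_two (T 0 q.1) (tensorOp fun i : Fin n => T i.succ (q.2 i))
    have h2 := (hT 0).tensorTwo ih (S := S) hS
    refine h2.reindex (Fin.consEquiv κ).symm (Fin.consEquiv X).symm (Fin.consEquiv Y).symm
      fun k y x => ?_
    rw [hS, entry_tensorOp, entry_tensorOp, Fin.prod_univ_succ]
    rfl

theorem isChannel_tensorOp {ι : Type} [Fintype ι] {κ X Y : ι → Type}
    {T : ∀ i, κ i → Op (X i) (Y i)} (hT : ∀ i, IsChannel (T i)) :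
    IsChannel fun k : ∀ i, κ i => tensorOp fun i => T i (k i) := by
  let e := (Fintype.equivFin ι).symm
  refine (isChannel_tensor_fin _ (fun j => κ (e j)) (fun j => X (e j)) (fun j => Y (e j))
    (fun j => T (e j)) fun j => hT (e j)).reindex (Equiv.piCongrLeft κ e).symm
    (Equiv.piCongrLeft X e).symm (Equiv.piCongrLeft Y e).symm fun k y x => ?_
  rw [entry_tensorOp, entry_tensorOp, ← Equiv.prod_comp e]
  rfl

theorem norm_tensorOp_apply {ι : Type} [Fintype ι] {X Y : ι → Type} {T : ∀ i, Op (X i) (Y i)}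
    (hT : ∀ i v, ‖T i v‖ = ‖v‖) (v : Hil (∀ i, X i)) : ‖tensorOp T v‖ = ‖v‖ := by
  have h := isChannel_tensorOp (κ := fun _ : ι => Unit) (T := fun i _ => T i)
    (fun i v => by simp [hT]) v
  exact (sq_eq_sq₀ (norm_nonneg _) (norm_nonneg _)).1 ((hasSum_unique _).unique h)

/-! ### Product vectors -/

theorem hasSum_mul_complex {I J : Type} {f : I → ℂ} {g : J → ℂ} {a b : ℂ} (hf : HasSum f a)
    (hg : HasSum g b) : HasSum (fun p : I × J => f p.1 * g p.2) (a * b) :=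
  hf.mul hg (summable_mul_of_summable_norm hf.summable.norm hg.summable.norm)

theorem hasSum_mul_real {I J : Type} {f : I → ℝ} {g : J → ℝ} {a b : ℝ} (hf : HasSum f a)
    (hg : HasSum g b) : HasSum (fun p : I × J => f p.1 * g p.2) (a * b) :=
  hf.mul hg (summable_mul_of_summable_norm hf.summable.norm hg.summable.norm)

theorem tensorTwo_apply_mul {T : Op X Y} {T' : Op X' Y'} {S : Op (X × X') (Y × Y')}
    (hS : ∀ y x, entry S y x = entry T y.1 x.1 * entry T' y.2 x.2) {f : Hil (X × X')}
    {a : Hil X} {b : Hil X'} (hf : ∀ x, f x = a x.1 * b x.2) (y : Y × Y') :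
    S f y = T a y.1 * T' b y.2 := by
  have h1 := hasSum_apply T a y.1
  have h2 := hasSum_apply T' b y.2
  refine (hasSum_apply S f y).unique ?_
  have h3 := hasSum_mul_complex h1 h2
  refine h3.congr_fun fun x => ?_
  rw [hS, hf]
  ring

section Partition

variable {ι : Type} {W W' : ι → Type}

open Classical in
/-- Sorting the systems by a bipartition of the parties. -/
def splitPart (W : ι → Type) (I : Set ι) :
    (∀ i, W i) ≃ (∀ i : I, W i) × (∀ i : ↥(Iᶜ), W i) where
  toFun x := (fun i => x i, fun i => x i)
  invFun z i := if h : i ∈ I then z.1 ⟨i, h⟩ else z.2 ⟨i, h⟩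
  left_inv x := by
    funext i
    by_cases h : i ∈ I <;> simp [h]
  right_inv z := by
    refine Prod.ext (funext fun i => ?_) (funext fun i => ?_)
    · simp [i.2]
    · have : (i : ι) ∉ I := i.2
      simp [this]

theorem norm_of_eq_mul (I : Set ι) {ψ : Hil (∀ i, W i)} {a : Hil (∀ i : I, W i)}
    {b : Hil (∀ i : ↥(Iᶜ), W i)} (h : ∀ x, ψ x = a (fun i => x i) * b (fun i => x i)) :
    ‖ψ‖ = ‖a‖ * ‖b‖ := by
  have h1 := hasSum_norm_sq a
  have h2 := hasSum_norm_sq b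
  have h3 := hasSum_mul_real h1 h2
  rw [← (splitPart W I).hasSum_iff] at h3
  have h4 : HasSum (fun x => ‖ψ x‖ ^ 2) (‖a‖ ^ 2 * ‖b‖ ^ 2) := by
    refine Eq.mp (congrArg (fun u => HasSum u _) (funext fun x => ?_)) h3
    rw [h, norm_mul, mul_pow]
    rfl
  have := (hasSum_norm_sq ψ).unique h4
  rw [← mul_pow] at this
  exact (sq_eq_sq₀ (norm_nonneg _) (by positivity)).1 this

theorem IsBiproduct.tensorOp [Fintype ι] (T : ∀ i, Op (W i) (W' i)) {ψ : Hil (∀ i, W i)}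
    (h : IsBiproduct ψ) : IsBiproduct (tensorOp T ψ) := by
  classical
  obtain ⟨I, hI, hI', a, b, hab⟩ := h
  refine ⟨I, hI, hI', CKA.tensorOp (fun i : I => T i) a,
    CKA.tensorOp (fun i : ↥(Iᶜ) => T i) b, fun y => ?_⟩
  obtain ⟨S, hS⟩ := exists_tensor_two (CKA.tensorOp fun i : I => T i)
    (CKA.tensorOp fun i : ↥(Iᶜ) => T i)
  have e : CKA.tensorOp T = (pull (splitPart W' I) (Equiv.injective _)).comp
      (S.comp (pull (splitPart W I).symm (Equiv.injective _))) := by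
    apply op_ext
    intro y x
    have : pull (splitPart W I).symm (Equiv.injective _) (ket x) = ket (splitPart W I x) := by
      ext z
      rw [pull_apply, ket_apply, ket_apply]
      simp [Equiv.symm_apply_eq]
    have e2 : entry ((pull (splitPart W' I) (Equiv.injective _)).comp
      (S.comp (pull (splitPart W I).symm (Equiv.injective _)))) y x
        = entry S (splitPart W' I y) (splitPart W I x) := by
      simp only [entry, ContinuousLinearMap.comp_apply, this]
      rfl
    rw [e2, hS, entry_tensorOp, entry_tensorOp, entry_tensorOp]
    rw [← Fintype.prod_subtype_mul_prod_subtype (fun i => i ∈ I)]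
    rfl
  rw [e, ContinuousLinearMap.comp_apply, ContinuousLinearMap.comp_apply, pull_apply]
  refine tensorTwo_apply_mul hS (fun x => ?_) _
  rw [pull_apply, hab]
  have := (splitPart W I).apply_symm_apply x
  exact congrArg₂ (fun u v => a u * b v) (congrArg Prod.fst this) (congrArg Prod.snd this)

end Partition

/-- The operator `|v⟩` from the trivial system. -/
def vecOp (v : Hil X) : Op Unit X :=
  (ContinuousLinearMap.toSpanSingleton ℂ v).comp (lp.evalCLM ℂ (fun _ : Unit => ℂ) 2 ())

theorem vecOp_apply (v : Hil X) (f : Hil Unit) : vecOp v f = f () • v := rfl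

theorem entry_vecOp (v : Hil X) (x : X) (u : Unit) : entry (vecOp v) x u = v x := by
  simp [entry, vecOp_apply, ket_apply]

theorem norm_hil_unit (f : Hil Unit) : ‖f‖ = ‖f ()‖ := by
  have h := (hasSum_norm_sq f).unique (hasSum_unique _)
  exact (sq_eq_sq₀ (norm_nonneg _) (norm_nonneg _)).1 h

theorem norm_vecOp_apply {v : Hil X} (hv : ‖v‖ = 1) (f : Hil Unit) : ‖vecOp v f‖ = ‖f‖ := by
  rw [vecOp_apply, norm_smul, hv, mul_one, norm_hil_unit]

/-- The product vector `⨂ i, φ i`. -/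
def prodVec {ι : Type} [Fintype ι] {W : ι → Type} (φ : ∀ i, Hil (W i)) : Hil (∀ i, W i) :=
  tensorOp (fun i => vecOp (φ i)) (ket fun _ => ())

theorem prodVec_apply {ι : Type} [Fintype ι] {W : ι → Type} (φ : ∀ i, Hil (W i)) (x : ∀ i, W i) :
    prodVec φ x = ∏ i, φ i (x i) := by
  have := entry_tensorOp (fun i => vecOp (φ i)) x (fun _ => ())
  simp only [entry_vecOp] at this
  exact this

theorem norm_prodVec {ι : Type} [Fintype ι] {W : ι → Type} {φ : ∀ i, Hil (W i)}
    (hφ : ∀ i, ‖φ i‖ = 1) : ‖prodVec φ‖ = 1 := by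
  unfold prodVec
  rw [norm_tensorOp_apply fun i => norm_vecOp_apply (hφ i), norm_ket]

theorem IsFullyProduct.exists_unit {ι : Type} [Fintype ι] {W : ι → Type} {ψ : Hil (∀ i, W i)}
    (h : IsFullyProduct ψ) (hψ : ‖ψ‖ = 1) :
    ∃ φ : ∀ i, Hil (W i), (∀ i, ‖φ i‖ = 1) ∧ ψ = prodVec φ := by
  obtain ⟨φ, hφ⟩ := h
  have h0 : ∀ i, φ i ≠ 0 := by
    intro i hi
    have : ψ = 0 := by
      ext x
      rw [hφ, Finset.prod_eq_zero (Finset.mem_univ i)]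
      · rfl
      · rw [hi]; rfl
    rw [this, norm_zero] at hψ
    exact zero_ne_one hψ
  let φ' : ∀ i, Hil (W i) := fun i => ((‖φ i‖ : ℂ)⁻¹) • φ i
  have hn : ∀ i, ‖φ' i‖ = 1 := by
    intro i
    have := norm_ne_zero_iff.2 (h0 i)
    simp [φ', norm_smul, this]
  have e : ψ = (∏ i, (‖φ i‖ : ℂ)) • prodVec φ' := by
    ext x
    rw [hφ, lp.coeFn_smul, Pi.smul_apply, prodVec_apply, smul_eq_mul, ← Finset.prod_mul_distrib]
    refine Finset.prod_congr rfl fun i _ => ?_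
    have : (‖φ i‖ : ℂ) ≠ 0 := by simpa using h0 i
    simp [φ', this]
  have h1 : (∏ i, ‖φ i‖) = 1 := by
    rw [e, norm_smul, norm_prodVec hn, mul_one, norm_prod] at hψ
    simpa using hψ
  refine ⟨φ', hn, ?_⟩
  rw [e, ← Complex.ofReal_prod, h1]
  simp

/-! ### Channels with references and tensor powers -/

section Multiplex

variable {α β γ κ : Type} {A' : α → Type} {B : β → Type} {A : α → Type} {C : γ → Type}

theorem withReferences_apply (N : MultiplexKraus κ A' B A C) (L : α → Type) (R : β → Type)
    (P : γ → Type) (k : κ) (f : Hil (∀ i, SysIn L A' R B P i)) (y : ∀ i, SysOut L A R P C i) :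
    withReferences N L R P k f y =
      N k (pull (fun w => (splitIn L A' R B P).symm ((splitOut L A R P C y).1, w))
        ((Equiv.injective _).comp (Prod.mk_right_injective _)) f) (splitOut L A R P C y).2 := by
  have h := hasSum_apply (withReferences N L R P k) f y
  have hi : Function.Injective fun w => (splitIn L A' R B P).symm ((splitOut L A R P C y).1, w) :=
    (Equiv.injective _).comp (Prod.mk_right_injective _)
  rw [← hi.hasSum_iff] at h
  · refine h.unique ?_
    refine Eq.mp (congrArg (fun u => HasSum u _) (funext fun x => ?_)) (hasSum_apply (N k) _ _)
    simp [entry_withReferences, pull_apply]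
  · intro x hx
    rw [entry_withReferences, if_neg, mul_zero]
    intro he
    refine hx ⟨(splitIn L A' R B P x).2, ?_⟩
    simp [he]

theorem IsChannel.withReferences {N : MultiplexKraus κ A' B A C} (hN : IsChannel N)
    (L : α → Type) (R : β → Type) (P : γ → Type) : IsChannel (withReferences N L R P) := by
  classical
  choose S hS using fun k => exists_ampliation ((∀ a, L a) × (∀ b, R b) × (∀ c, P c)) (N k)
  refine (hN.ampliation hS).reindex (Equiv.refl _) (splitIn L A' R B P) (splitOut L A R P C)
    fun k y x => ?_
  rw [Equiv.refl_apply, hS, entry_withReferences]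
  congr

theorem IsChannel.tensorPower {N : MultiplexKraus κ A' B A C} (hN : IsChannel N) (n : ℕ) :
    IsChannel (tensorPower N n) := by
  refine (isChannel_tensorOp (ι := Fin n) (κ := fun _ => κ) (T := fun _ => N) fun _ => hN).reindex
    (Equiv.refl _) (splitPower A' B n) (splitPower A C n) fun k y x => ?_
  rw [entry_tensorPower, entry_tensorOp]
  rfl

end Multiplex

end

/-! ### The fidelity bound -/

section Fidelity

variable {X Y : Type}

theorem opSqrt_nonneg {H : Type} [NormedAddCommGroup H] [InnerProductSpace ℂ H] [CompleteSpace H]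
    (T : H →L[ℂ] H) : 0 ≤ opSqrt T := CFC.sqrt_nonneg T

theorem opSqrt_comp_self {H : Type} [NormedAddCommGroup H] [InnerProductSpace ℂ H]
    [CompleteSpace H] {T : H →L[ℂ] H} (hT : 0 ≤ T) : opSqrt T ∘L opSqrt T = T :=
  CFC.sqrt_mul_sqrt_self T hT

theorem adjoint_of_nonneg {T : Op X X} (hT : 0 ≤ T) : ContinuousLinearMap.adjoint T = T :=
  (IsSelfAdjoint.of_nonneg hT).adjoint_eq

theorem inner_symm_of_nonneg {T : Op X X} (hT : 0 ≤ T) (u v : Hil X) :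
    inner ℂ (T u) v = inner ℂ u (T v) := by
  rw [← ContinuousLinearMap.adjoint_inner_right, adjoint_of_nonneg hT]

theorem re_inner_nonneg {T : Op X X} (hT : 0 ≤ T) (v : Hil X) : 0 ≤ (inner ℂ v (T v)).re := by
  rw [ContinuousLinearMap.nonneg_iff_isPositive] at hT
  exact hT.re_inner_nonneg_right v

theorem norm_sq_eq_re_inner (v : Hil X) : (inner ℂ v v).re = ‖v‖ ^ 2 := by
  rw [← inner_self_eq_norm_sq (𝕜 := ℂ) v]; rfl

theorem re_inner_le (u v : Hil X) : (inner ℂ u v).re ≤ ‖u‖ * ‖v‖ :=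
  (Complex.re_le_norm _).trans (norm_inner_le_norm _ _)

/-- A regularised polar decomposition of `M`, where `P = |M|`. -/
theorem exists_approx_polar {M : Op X Y} {P : Op X X} (hP : 0 ≤ P)
    (h : P ∘L P = ContinuousLinearMap.adjoint M ∘L M) {δ : ℝ} (hδ : 0 < δ) :
    ∃ W : Op X Y, (∀ x, ‖W x‖ ≤ ‖x‖) ∧
      ∀ x, (inner ℂ x (P x)).re ≤ (inner ℂ (W x) (M x)).re + δ * ‖x‖ ^ 2 := by
  have hunit : IsUnit (algebraMap ℝ (Op X X) (-δ) - P) := by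
    rw [← spectrum.notMem_iff]
    intro hm
    have := spectrum_nonneg_of_nonneg hP hm
    linarith
  obtain ⟨u, hu⟩ := hunit
  let R : Op X X := -(↑u⁻¹ : Op X X)
  have hR : ∀ x, P (R x) + (δ : ℂ) • R x = x := by
    intro x
    have h1 : (u : Op X X) * (↑u⁻¹ : Op X X) = 1 := u.mul_inv
    rw [hu] at h1
    have h2 := congrArg (fun T : Op X X => T x) h1
    simp only [mul_apply_eq_comp, sub_apply, one_apply_eq_self,
      Algebra.algebraMap_eq_smul_one, smul_apply] at h2
    simp only [R, neg_apply, map_neg, smul_neg, Complex.coe_smul]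
    rw [neg_smul] at h2
    rw [add_comm, ← sub_eq_add_neg]
    exact h2
  have hM : ∀ u v, inner ℂ (M u) (M v) = inner ℂ (P u) (P v) := by
    intro u v
    rw [← ContinuousLinearMap.adjoint_inner_right, ← ContinuousLinearMap.comp_apply, ← h,
      ContinuousLinearMap.comp_apply, inner_symm_of_nonneg hP]
  have hPR : ∀ x, ‖P (R x)‖ ≤ ‖x‖ := by
    intro x
    refine le_of_sq_le_sq ?_ (norm_nonneg _)
    have h0 := re_inner_nonneg hP (R x)
    have e : ‖x‖ ^ 2 = ‖P (R x)‖ ^ 2 + 2 * (δ * (inner ℂ (R x) (P (R x))).re)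
        + δ ^ 2 * ‖R x‖ ^ 2 := by
      conv_lhs => rw [← hR x]
      rw [← norm_sq_eq_re_inner, ← norm_sq_eq_re_inner, ← norm_sq_eq_re_inner]
      simp only [inner_add_left, inner_add_right, inner_smul_left, inner_smul_right,
        Complex.conj_ofReal, Complex.add_re, Complex.re_ofReal_mul,
        inner_symm_of_nonneg hP (R x) (R x)]
      ring
    rw [e]
    have : 0 ≤ δ ^ 2 * ‖R x‖ ^ 2 := by positivity
    nlinarith [mul_nonneg hδ.le h0]
  refine ⟨M ∘L R, fun x => ?_, fun x => ?_⟩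
  · refine le_of_sq_le_sq ?_ (norm_nonneg _)
    rw [ContinuousLinearMap.comp_apply, ← norm_sq_eq_re_inner, hM, norm_sq_eq_re_inner]
    exact pow_le_pow_left₀ (norm_nonneg _) (hPR x) 2
  · rw [ContinuousLinearMap.comp_apply, hM]
    have e : (inner ℂ (P (R x)) (P x)).re
        = (inner ℂ x (P x)).re - δ * (inner ℂ (P (R x)) x).re := by
      have h1 : P (R x) = x - (δ : ℂ) • R x := eq_sub_of_add_eq (hR x)
      conv_lhs => rw [h1]
      simp only [inner_sub_left, inner_smul_left, Complex.conj_ofReal, Complex.sub_re,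
        Complex.re_ofReal_mul, inner_symm_of_nonneg hP]
    have h2 : (inner ℂ (P (R x)) x).re ≤ ‖x‖ ^ 2 := by
      refine (re_inner_le _ _).trans ?_
      rw [sq]
      exact mul_le_mul_of_nonneg_right (hPR x) (norm_nonneg _)
    rw [e]
    nlinarith [mul_le_mul_of_nonneg_left h2 hδ.le]

theorem hasSum_norm_sq_opSqrt {ω : Op Y Y} (hω : IsDensity ω) :
    HasSum (fun y => ‖opSqrt ω (ket y)‖ ^ 2) 1 := by
  have hω0 : 0 ≤ ω := (ContinuousLinearMap.nonneg_iff_isPositive _).2 hω.1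
  have h1 : HasSum (fun y => (entry ω y y).re) 1 := Complex.hasSum_re hω.2
  refine h1.congr_fun fun y => ?_
  rw [← norm_sq_eq_re_inner, inner_symm_of_nonneg (opSqrt_nonneg ω),
    ← ContinuousLinearMap.comp_apply, opSqrt_comp_self hω0, entry_eq_inner]

theorem IsEnsemble.hasSum_adjoint_comp_opSqrt {J : Type} (V : Op Y X) {τ : Op X X}
    {v : J → Hil X} {t f : ℝ} (hτ : IsEnsemble v t τ)
    (hf : HasSum (fun j => ‖ContinuousLinearMap.adjoint V (v j)‖ ^ 2) f) :
    HasSum (fun x => ‖(ContinuousLinearMap.adjoint V ∘L opSqrt τ) (ket x)‖ ^ 2) f := by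
  have hs0 := opSqrt_nonneg τ
  have h1 : HasSum (fun y => ‖(opSqrt τ ∘L V) (ket y)‖ ^ 2) f := by
    have h2 : Summable fun p : J × Y => ‖(ContinuousLinearMap.adjoint V (v p.1)) p.2‖ ^ 2 := by
      rw [summable_prod_of_nonneg (fun _ => by positivity)]
      refine ⟨fun j => (hasSum_norm_sq (ContinuousLinearMap.adjoint V (v j))).summable, ?_⟩
      simpa only [(hasSum_norm_sq _).tsum_eq] using hf.summable
    have h3 := h2.hasSum
    have e : ∑' p : J × Y, ‖(ContinuousLinearMap.adjoint V (v p.1)) p.2‖ ^ 2 = f :=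
      (h3.prod_fiberwise fun j =>
        hasSum_norm_sq (ContinuousLinearMap.adjoint V (v j))).unique hf
    rw [e] at h3
    have h5 := (Equiv.prodComm Y J).hasSum_iff.2 h3
    refine h5.prod_fiberwise fun y => ?_
    have h4 := hτ.hasSum_inner (V (ket y))
    have e2 : (inner ℂ (V (ket y)) (τ (V (ket y)))).re = ‖(opSqrt τ ∘L V) (ket y)‖ ^ 2 := by
      conv_lhs => rw [← opSqrt_comp_self hτ.isPositive]
      rw [ContinuousLinearMap.comp_apply, ← inner_symm_of_nonneg hs0, norm_sq_eq_re_inner]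
      rfl
    rw [e2] at h4
    refine h4.congr_fun fun j => ?_
    rw [← ContinuousLinearMap.adjoint_inner_right, inner_ket_left]
    rfl
  have h2 := hasSum_norm_sq_adjoint h1
  rwa [ContinuousLinearMap.adjoint_comp, adjoint_of_nonneg hs0] at h2

/-- The fidelity with `V ω V†` is at most the probability that the state lies in the range
of `V`. -/
theorem fidelity_le_hasSum {J : Type} {V : Op Y X} {ω : Op Y Y} (hω : IsDensity ω) {τ : Op X X}
    {v : J → Hil X} {t f : ℝ} (hτ : IsEnsemble v t τ)
    (hf : HasSum (fun j => ‖ContinuousLinearMap.adjoint V (v j)‖ ^ 2) f) :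
    fidelity (V ∘L ω ∘L ContinuousLinearMap.adjoint V) τ ≤ f := by
  have hω0 : 0 ≤ ω := (ContinuousLinearMap.nonneg_iff_isPositive _).2 hω.1
  have hτ0 := hτ.isPositive
  have hs0 := opSqrt_nonneg τ
  have hr0 := opSqrt_nonneg ω
  set s := opSqrt τ with hs
  set r := opSqrt ω with hr
  have hss : s ∘L s = τ := opSqrt_comp_self hτ0
  have hrr : r ∘L r = ω := opSqrt_comp_self hω0
  have hsa := adjoint_of_nonneg hs0
  have hra := adjoint_of_nonneg hr0
  have hr1 : HasSum (fun y => ‖r (ket y)‖ ^ 2) 1 := hasSum_norm_sq_opSqrt hω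
  have hVs : HasSum (fun x => ‖(ContinuousLinearMap.adjoint V ∘L s) (ket x)‖ ^ 2) f :=
    hτ.hasSum_adjoint_comp_opSqrt V hf
  set M : Op X Y := r ∘L ContinuousLinearMap.adjoint V ∘L s with hM
  set P := opSqrt (s ∘L (V ∘L ω ∘L ContinuousLinearMap.adjoint V) ∘L s) with hP
  have hMM : ContinuousLinearMap.adjoint M ∘L M
      = s ∘L (V ∘L ω ∘L ContinuousLinearMap.adjoint V) ∘L s := by
    rw [hM, ContinuousLinearMap.adjoint_comp, ContinuousLinearMap.adjoint_comp, hsa, hra,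
      ContinuousLinearMap.adjoint_adjoint, ← hrr]
    simp only [ContinuousLinearMap.comp_assoc]
  have hP0 : 0 ≤ P := opSqrt_nonneg _
  have hPP : P ∘L P = ContinuousLinearMap.adjoint M ∘L M := by
    rw [hMM]
    refine opSqrt_comp_self ?_
    rw [← hMM, ContinuousLinearMap.nonneg_iff_isPositive]
    exact ContinuousLinearMap.isPositive_adjoint_comp_self M
  have hbound : ∀ F : Finset X, ∑ x ∈ F, (inner ℂ (ket x) (P (ket x))).re ≤ Real.sqrt f := by
    intro F
    refine le_of_forall_pos_le_add fun η hη => ?_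
    obtain ⟨W, hW, hWP⟩ := exists_approx_polar hP0 hPP
      (δ := η / (F.card + 1)) (by positivity)
    have hWn : ‖ContinuousLinearMap.adjoint W‖ ≤ 1 := by
      rw [LinearIsometryEquiv.norm_map]
      exact W.opNorm_le_bound zero_le_one fun x => by rw [one_mul]; exact hW x
    have hle : ∀ y, ‖(ContinuousLinearMap.adjoint W ∘L r) (ket y)‖ ^ 2 ≤ ‖r (ket y)‖ ^ 2 := by
      intro y
      refine pow_le_pow_left₀ (norm_nonneg _) ?_ 2
      refine ((ContinuousLinearMap.adjoint W).le_opNorm _).trans ?_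
      exact mul_le_of_le_one_left (norm_nonneg _) hWn
    have hWs := Summable.of_nonneg_of_le (fun _ => by positivity) hle hr1.summable
    have h1 := hasSum_norm_sq_adjoint hWs.hasSum
    rw [ContinuousLinearMap.adjoint_comp, hra, ContinuousLinearMap.adjoint_adjoint] at h1
    have h2 := hasSum_le hle hWs.hasSum hr1
    calc ∑ x ∈ F, (inner ℂ (ket x) (P (ket x))).re
        ≤ ∑ x ∈ F, (‖(r ∘L W) (ket x)‖ * ‖(ContinuousLinearMap.adjoint V ∘L s) (ket x)‖
            + η / (F.card + 1)) := by
          refine Finset.sum_le_sum fun x _ => (hWP (ket x)).trans ?_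
          rw [norm_ket, one_pow, mul_one]
          gcongr
          rw [hM, ContinuousLinearMap.comp_apply, ← inner_symm_of_nonneg hr0]
          exact re_inner_le _ _
      _ = ∑ x ∈ F, ‖(r ∘L W) (ket x)‖ * ‖(ContinuousLinearMap.adjoint V ∘L s) (ket x)‖
            + F.card * (η / (F.card + 1)) := by
          rw [Finset.sum_add_distrib, Finset.sum_const, nsmul_eq_mul]
      _ ≤ 1 * Real.sqrt f + η := by
          gcongr
          · refine (Real.sum_mul_le_sqrt_mul_sqrt _ _ _).trans ?_
            refine mul_le_mul ?_ ?_ (Real.sqrt_nonneg _) zero_le_one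
            · refine Real.sqrt_le_one.2 ?_
              exact (sum_le_hasSum F (fun _ _ => by positivity) h1).trans h2
            · exact Real.sqrt_le_sqrt (sum_le_hasSum F (fun _ _ => by positivity) hVs)
          · rw [mul_div_assoc', div_le_iff₀ (by positivity)]
            nlinarith
      _ = Real.sqrt f + η := by rw [one_mul]
  have htr : tr P = ((∑' x, (inner ℂ (ket x) (P (ket x))).re : ℝ) : ℂ) := by
    unfold tr
    rw [Complex.ofReal_tsum]
    refine tsum_congr fun x => ?_
    rw [entry_eq_inner]
    refine (Complex.conj_eq_iff_re.1 ?_).symm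
    rw [inner_conj_symm, inner_symm_of_nonneg hP0]
  have hf0 : 0 ≤ f := hf.nonneg fun _ => by positivity
  unfold fidelity
  rw [← hs, ← hP, htr, Complex.ofReal_re]
  refine (pow_le_pow_left₀ (tsum_nonneg fun x => re_inner_nonneg hP0 _)
    (Real.tsum_le_of_sum_le (fun x => re_inner_nonneg hP0 _) hbound) 2).trans ?_
  rw [Real.sq_sqrt hf0]

end Fidelity

/-! ### Private states -/

section PrivateStates

variable {ι : Type} {K : ℕ} {S : ι → Type}

theorem adjoint_keyKet (k : ι → Fin K) :
    ContinuousLinearMap.adjoint (keyKet (S := S) k)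
      = pull (fun (s : ∀ i, S i) i => (k i, s i)) (keyKet_aux k) := by
  classical
  apply op_ext
  intro s z
  rw [entry_adjoint, entry_keyKet]
  simp only [entry, pull_apply, ket_apply]
  split_ifs <;> simp_all

theorem adjoint_keyKet_comp_self (k : ι → Fin K) :
    ContinuousLinearMap.adjoint (keyKet (S := S) k) ∘L keyKet k = ContinuousLinearMap.id ℂ _ := by
  classical
  rw [adjoint_keyKet]
  apply op_ext
  intro s s'
  change entry (keyKet k) (fun i => (k i, s i)) s' = ket s' s
  rw [entry_keyKet, ket_apply]
  exact if_congr (keyKet_aux k).eq_iff rfl rfl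

theorem adjoint_keyKet_comp_of_ne {k l : ι → Fin K} (h : k ≠ l) :
    ContinuousLinearMap.adjoint (keyKet (S := S) k) ∘L keyKet l = 0 := by
  classical
  rw [adjoint_keyKet]
  apply op_ext
  intro s s'
  change entry (keyKet l) (fun i => (k i, s i)) s' = 0
  rw [entry_keyKet, if_neg]
  intro he
  exact h (funext fun i => congrArg Prod.fst (congrFun he i))

theorem sum_norm_sq_key_le [Nonempty ι] (ξ : Hil (∀ i, Fin K × S i)) :
    ∑ k : Fin K, ‖pull (fun (s : ∀ i, S i) i => (k, s i)) (keyKet_aux fun _ => k) ξ‖ ^ 2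
      ≤ ‖ξ‖ ^ 2 := by
  have hi : Function.Injective fun (q : Fin K × ∀ i, S i) (i : ι) => (q.1, q.2 i) := by
    intro q q' h
    refine Prod.ext ?_ (funext fun i => congrArg Prod.snd (congrFun h i))
    have := congrFun h (Classical.arbitrary ι)
    exact (Prod.ext_iff.1 this).1
  have h1 : HasSum (fun k : Fin K =>
      ‖pull (fun (s : ∀ i, S i) i => (k, s i)) (keyKet_aux fun _ => k) ξ‖ ^ 2)
      (‖pull _ hi ξ‖ ^ 2) :=
    (hasSum_norm_sq (pull _ hi ξ)).prod_fiberwise fun k => hasSum_norm_sq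
      (pull (fun (s : ∀ i, S i) i => (k, s i)) (keyKet_aux fun _ => k) ξ)
  rw [(hasSum_fintype _).unique h1]
  exact pow_le_pow_left₀ (norm_nonneg _) (norm_pull_le _ _ _) 2

theorem sum_norm_key_le_of_isBiproduct {ξ : Hil (∀ i, Fin K × S i)} (h : IsBiproduct ξ) :
    ∑ k : Fin K, ‖pull (fun (s : ∀ i, S i) i => (k, s i)) (keyKet_aux fun _ => k) ξ‖ ≤ ‖ξ‖ := by
  obtain ⟨I, hI, hI', a, b, hab⟩ := h
  have : Nonempty I := hI.to_subtype
  have : Nonempty ↥(Iᶜ) := hI'.to_subtype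
  have e : ∀ k : Fin K, ‖pull (fun (s : ∀ i, S i) i => (k, s i)) (keyKet_aux fun _ => k) ξ‖
      = ‖pull (fun (s : ∀ i : I, S i) i => (k, s i)) (keyKet_aux fun _ => k) a‖
        * ‖pull (fun (s : ∀ i : ↥(Iᶜ), S i) i => (k, s i)) (keyKet_aux fun _ => k) b‖ :=
    fun k => norm_of_eq_mul I fun x => hab _
  simp only [e]
  rw [norm_of_eq_mul I hab]
  refine (Real.sum_mul_le_sqrt_mul_sqrt _ _ _).trans ?_
  refine mul_le_mul ?_ ?_ (Real.sqrt_nonneg _) (norm_nonneg _)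
  · exact (Real.sqrt_le_left (norm_nonneg _)).2 (sum_norm_sq_key_le a)
  · exact (Real.sqrt_le_left (norm_nonneg _)).2 (sum_norm_sq_key_le b)

variable [Fintype ι]

theorem twisting_comp_keyKet (U : (ι → Fin K) → Op (∀ i, S i) (∀ i, S i)) (l : ι → Fin K) :
    twisting U ∘L keyKet l = keyKet l ∘L U l := by
  classical
  unfold twisting
  rw [ContinuousLinearMap.finsetSum_comp, Finset.sum_eq_single l]
  · rw [ContinuousLinearMap.comp_assoc, ContinuousLinearMap.comp_assoc, adjoint_keyKet_comp_self,
      ContinuousLinearMap.comp_id]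
  · intro k _ hk
    rw [ContinuousLinearMap.comp_assoc, ContinuousLinearMap.comp_assoc,
      adjoint_keyKet_comp_of_ne hk, ContinuousLinearMap.comp_zero, ContinuousLinearMap.comp_zero]
  · simp

/-- The isometry `V` with `V ω V† = U (Φ^GHZ ⊗ ω) U†`. -/
def privateIsometry (U : (ι → Fin K) → Op (∀ i, S i) (∀ i, S i)) :
    Op (∀ i, S i) (∀ i, Fin K × S i) :=
  (((Real.sqrt K)⁻¹ : ℝ) : ℂ) • (twisting U ∘L ∑ k : Fin K, keyKet fun _ => k)

theorem IsPrivateState.exists_isometry {priv : Op (∀ i, Fin K × S i) (∀ i, Fin K × S i)}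
    (h : IsPrivateState priv) :
    ∃ (U : (ι → Fin K) → Op (∀ i, S i) (∀ i, S i)) (ω : Op (∀ i, S i) (∀ i, S i)),
      (∀ k, U k ∈ unitary (Op (∀ i, S i) (∀ i, S i))) ∧ IsDensity ω ∧
      priv = privateIsometry U ∘L ω ∘L ContinuousLinearMap.adjoint (privateIsometry U) := by
  obtain ⟨U, ω, hU, hω, rfl⟩ := h
  refine ⟨U, ω, hU, hω, ?_⟩
  unfold privateIsometry ghzTensor
  have hc : ((((Real.sqrt K)⁻¹ : ℝ) : ℂ)) * (((Real.sqrt K)⁻¹ : ℝ) : ℂ) = 1 / (K : ℂ) := by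
    rw [← Complex.ofReal_mul, ← mul_inv, Real.mul_self_sqrt (Nat.cast_nonneg K)]
    simp
  have hE : ∑ k : Fin K, ∑ l : Fin K,
      keyKet (fun _ => k) ∘L ω ∘L ContinuousLinearMap.adjoint (keyKet fun _ => l)
      = (∑ k : Fin K, keyKet fun _ => k) ∘L ω ∘L
        ContinuousLinearMap.adjoint (∑ k : Fin K, keyKet (S := S) fun _ => k) := by
    rw [map_sum, ContinuousLinearMap.finsetSum_comp]
    refine Finset.sum_congr rfl fun k _ => ?_
    rw [ContinuousLinearMap.comp_finsetSum, ContinuousLinearMap.comp_finsetSum]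
  rw [hE, ← hc, map_smulₛₗ, Complex.conj_ofReal, ContinuousLinearMap.adjoint_comp]
  simp only [ContinuousLinearMap.smul_comp, ContinuousLinearMap.comp_smul,
    ContinuousLinearMap.comp_assoc, mul_smul]

theorem norm_adjoint_privateIsometry_le {U : (ι → Fin K) → Op (∀ i, S i) (∀ i, S i)}
    (hU : ∀ k, U k ∈ unitary (Op (∀ i, S i) (∀ i, S i))) (ξ : Hil (∀ i, Fin K × S i)) :
    ‖ContinuousLinearMap.adjoint (privateIsometry U) ξ‖ ≤ (Real.sqrt K)⁻¹ *
      ∑ k : Fin K, ‖pull (fun (s : ∀ i, S i) i => (k, s i)) (keyKet_aux fun _ => k) ξ‖ := by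
  have e : privateIsometry U = (((Real.sqrt K)⁻¹ : ℝ) : ℂ) •
      ∑ k : Fin K, keyKet (fun _ => k) ∘L U fun _ => k := by
    unfold privateIsometry
    rw [ContinuousLinearMap.comp_finsetSum]
    simp only [twisting_comp_keyKet]
  rw [e, map_smulₛₗ, smul_apply, norm_smul]
  have hn : ‖(starRingEnd ℂ) ((((Real.sqrt K)⁻¹ : ℝ) : ℂ))‖ = (Real.sqrt K)⁻¹ := by
    rw [RCLike.norm_conj, Complex.norm_real, Real.norm_eq_abs, abs_of_nonneg (by positivity)]
  rw [hn, map_sum, sum_apply]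
  gcongr
  refine (norm_sum_le _ _).trans (Finset.sum_le_sum fun k _ => ?_)
  rw [ContinuousLinearMap.adjoint_comp, ContinuousLinearMap.comp_apply, adjoint_keyKet]
  refine le_of_eq ?_
  exact ContinuousLinearMap.norm_map_of_mem_unitary (Unitary.star_mem (hU _)) _

theorem norm_adjoint_privateIsometry_le_norm [Nonempty ι]
    {U : (ι → Fin K) → Op (∀ i, S i) (∀ i, S i)}
    (hU : ∀ k, U k ∈ unitary (Op (∀ i, S i) (∀ i, S i))) (ξ : Hil (∀ i, Fin K × S i)) :
    ‖ContinuousLinearMap.adjoint (privateIsometry U) ξ‖ ≤ ‖ξ‖ := by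
  refine (norm_adjoint_privateIsometry_le hU ξ).trans ?_
  have h := Real.sum_mul_le_sqrt_mul_sqrt Finset.univ (fun _ : Fin K => (1 : ℝ)) fun k =>
    ‖pull (fun (s : ∀ i, S i) i => (k, s i)) (keyKet_aux fun _ => k) ξ‖
  simp only [one_mul, one_pow, Finset.sum_const, Finset.card_univ, Fintype.card_fin, nsmul_eq_mul,
    mul_one] at h
  have h2 := (Real.sqrt_le_left (norm_nonneg ξ)).2 (sum_norm_sq_key_le ξ)
  rcases Nat.eq_zero_or_pos K with rfl | hK
  · simp
  · rw [inv_mul_le_iff₀ (Real.sqrt_pos.2 (by exact_mod_cast hK))]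
    exact h.trans (mul_le_mul_of_nonneg_left h2 (Real.sqrt_nonneg _))

/-- A biseparable state passes the privacy test with probability at most `1 / K`. -/
theorem norm_sq_adjoint_privateIsometry_le {U : (ι → Fin K) → Op (∀ i, S i) (∀ i, S i)}
    (hU : ∀ k, U k ∈ unitary (Op (∀ i, S i) (∀ i, S i))) {ξ : Hil (∀ i, Fin K × S i)}
    (hξ : IsBiproduct ξ) :
    ‖ContinuousLinearMap.adjoint (privateIsometry U) ξ‖ ^ 2 ≤ (K : ℝ)⁻¹ * ‖ξ‖ ^ 2 := by
  have h := (norm_adjoint_privateIsometry_le hU ξ).trans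
    (mul_le_mul_of_nonneg_left (sum_norm_key_le_of_isBiproduct hξ) (by positivity))
  refine (pow_le_pow_left₀ (norm_nonneg _) h 2).trans ?_
  rw [mul_pow, inv_pow, Real.sq_sqrt (Nat.cast_nonneg K)]

end PrivateStates

/-! ### Mixtures and hypothesis tests -/

section Testing

variable {X Y : Type}

theorem isMixtureOf_proj {Q : Hil X → Prop} {v : Hil X} (hv : ‖v‖ = 1) (hQ : Q v) :
    IsMixtureOf Q (proj v) := by
  refine ⟨fun n => if n = 0 then 1 else 0, fun _ => v, fun n => by positivity,
    hasSum_ite_eq 0 1, fun _ => ⟨hv, hQ⟩, ?_⟩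
  refine (hasSum_ite_eq 0 (proj v)).congr_fun fun n => ?_
  by_cases h : n = 0 <;> simp [h]

theorem IsMixtureOf.exists_isEnsemble {Q : Hil X → Prop} (hQ : ∀ (c : ℂ) v, Q v → Q (c • v))
    {ρ : Op X X} (h : IsMixtureOf Q ρ) :
    ∃ v : ℕ → Hil X, IsEnsemble v 1 ρ ∧ ∀ n, Q (v n) := by
  obtain ⟨p, ψ, hp, h1, hψ, h⟩ := h
  exact ⟨_, IsMixtureOf.isEnsemble hp h1 hψ h, fun n => hQ _ _ (hψ n).2⟩

theorem IsBiproduct.smul {ι : Type} {W : ι → Type} (c : ℂ) {ψ : Hil (∀ i, W i)}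
    (h : IsBiproduct ψ) : IsBiproduct (c • ψ) := by
  obtain ⟨I, hI, hI', a, b, hab⟩ := h
  refine ⟨I, hI, hI', c • a, b, fun x => ?_⟩
  rw [lp.coeFn_smul, lp.coeFn_smul, Pi.smul_apply, Pi.smul_apply, hab, smul_eq_mul, smul_eq_mul,
    mul_assoc]

theorem exists_isEnsemble_of_mem_BS {ι : Type} {W : ι → Type} {σ : Op (∀ i, W i) (∀ i, W i)}
    (hσ : σ ∈ BS W) : ∃ v : ℕ → Hil (∀ i, W i), IsEnsemble v 1 σ ∧ ∀ n, IsBiproduct (v n) :=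
  IsMixtureOf.exists_isEnsemble (fun c _ h => h.smul c) hσ

theorem IsEnsemble.tr_nonneg {J : Type} {v : J → Hil X} {t : ℝ} {ρ : Op X X}
    (h : IsEnsemble v t ρ) {Λ : Op X X} (hΛ : 0 ≤ Λ) : 0 ≤ (tr (Λ ∘L ρ)).re :=
  (h.tr_eq Λ).nonneg fun _ => re_inner_nonneg hΛ _

theorem IsEnsemble.tr_one {J : Type} {v : J → Hil X} {t : ℝ} {ρ : Op X X}
    (h : IsEnsemble v t ρ) : (tr ((1 : Op X X) ∘L ρ)).re = t := by
  refine (h.tr_eq 1).unique (h.norm_sq.congr_fun fun j => ?_)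
  rw [one_apply_eq_self, norm_sq_eq_re_inner]

theorem le_stateEhGE_of_test {ι : Type} {W : ι → Type} {ε : ℝ} {ρ Λ : Op (∀ i, W i) (∀ i, W i)}
    {K : ℕ} (h0 : 0 ≤ Λ) (h1 : Λ ≤ 1) (hρ : 1 - ε ≤ (tr (Λ ∘L ρ)).re)
    (hσ : ∀ σ ∈ BS W, (tr (Λ ∘L σ)).re ≤ (K : ℝ)⁻¹) :
    ((Real.logb 2 K : ℝ) : EReal) ≤ stateEhGE ε ρ := by
  unfold stateEhGE
  refine le_iInf₂ fun σ hm => ?_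
  obtain ⟨v, hv, -⟩ := exists_isEnsemble_of_mem_BS hm
  have hle : optimalError ε ρ σ ≤ (K : ℝ)⁻¹ := by
    unfold optimalError
    have hmem : (tr (Λ ∘L σ)).re ∈ {t : ℝ | ∃ Λ' : Op (∀ i, W i) (∀ i, W i), 0 ≤ Λ' ∧ Λ' ≤ 1 ∧
        1 - ε ≤ (tr (Λ' ∘L ρ)).re ∧ t = (tr (Λ' ∘L σ)).re} := ⟨Λ, h0, h1, hρ, rfl⟩
    refine (csInf_le ⟨0, ?_⟩ hmem).trans (hσ σ hm)
    rintro t ⟨Λ', h0', -, -, rfl⟩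
    exact hv.tr_nonneg h0'
  unfold hypothesisTestingDivergence
  split_ifs with he
  · exact le_top
  · rw [EReal.coe_le_coe_iff, le_neg, ← Real.logb_inv]
    exact Real.logb_le_logb_of_le (by norm_num) (not_le.1 he) hle

theorem exists_le_of_hasSum_mul {p f : ℕ → ℝ} {s c : ℝ} (hp : ∀ n, 0 ≤ p n) (h1 : HasSum p 1)
    (hs : HasSum (fun n => p n * f n) s) (hc : c ≤ s) : ∃ n, c ≤ f n := by
  by_contra! h
  obtain ⟨n, hn⟩ : ∃ n, p n ≠ 0 := by
    by_contra! h0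
    rw [funext h0] at h1
    exact zero_ne_one (hasSum_zero.unique h1)
  have hlt := hasSum_lt (i := n) (fun m => mul_le_mul_of_nonneg_left (h m).le (hp m))
    (mul_lt_mul_of_pos_left (h n) ((hp n).lt_of_ne' hn)) hs (h1.mul_right c)
  rw [one_mul] at hlt
  exact absurd hc (not_le.2 hlt)

theorem IsChannel.comp_contraction {κ Z : Type} {T : κ → Op X Y} (hT : IsChannel T) {A : Op Y Z}
    (hA : ∀ ξ, ‖A ξ‖ ≤ ‖ξ‖) : IsTraceNonincreasing fun k => A ∘L T k := by
  intro v s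
  refine (Finset.sum_le_sum fun k _ => pow_le_pow_left₀ (norm_nonneg _) (hA (T k v)) 2).trans ?_
  exact sum_le_hasSum s (fun _ _ => by positivity) (hT v)

end Testing

/-! ### Removing the reference systems of the receivers -/

section Attach

variable {X Z : Type}

theorem exists_attach (v : Hil Z) : ∃ S : Op (Unit × X) (Z × X), ∀ y x,
    entry S y x = entry (vecOp v) y.1 x.1 * entry (ContinuousLinearMap.id ℂ (Hil X)) y.2 x.2 :=
  exists_tensor_two _ _

/-- Preparation of the state `v` of a reference system. -/
def attach (v : Hil Z) : Op (Unit × X) (Z × X) :=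
  (exists_attach v).choose

open Classical in
theorem entry_attach (v : Hil Z) (y : Z × X) (x : Unit × X) :
    entry (attach v) y x = if y.2 = x.2 then v y.1 else 0 := by
  unfold attach
  rw [(exists_attach v).choose_spec, entry_vecOp]
  simp only [entry, ContinuousLinearMap.id_apply, ket_apply]
  split_ifs <;> simp

theorem norm_attach_apply {v : Hil Z} (hv : ‖v‖ = 1) (f : Hil (Unit × X)) :
    ‖attach v f‖ = ‖f‖ := by
  have h1 : IsChannel fun _ : Unit => vecOp v := fun f => by simp [norm_vecOp_apply hv]
  have h2 : IsChannel fun _ : Unit => ContinuousLinearMap.id ℂ (Hil X) := fun f => by simp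
  have h := h1.tensorTwo h2 (S := fun _ => attach v) (fun _ => (exists_attach v).choose_spec) f
  have h' := h.unique (hasSum_fintype _)
  simp only [Finset.sum_const, Finset.card_univ, Fintype.card_prod,
    Fintype.card_unit, mul_one, one_smul] at h'
  exact ((sq_eq_sq₀ (norm_nonneg _) (norm_nonneg _)).1 h').symm

variable {α β γ κ : Type} {A' : α → Type} {B : β → Type} {A : α → Type} {C : γ → Type}
  {L : α → Type} {R : β → Type} {P : γ → Type}

/-- The receivers prepare the states `φ c` of their reference systems. -/
def prepareReceivers (L A : α → Type) (R : β → Type) (C : γ → Type) (φ : ∀ c, Hil (P c)) :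
    ∀ i, Op (SysOut L A R (fun _ : γ => Unit) C i) (SysOut L A R P C i)
  | .inl a => ContinuousLinearMap.id ℂ (Hil (L a × A a))
  | .inr (.inl b) => ContinuousLinearMap.id ℂ (Hil (R b))
  | .inr (.inr c) => (attach (φ c) : Op (Unit × C c) (P c × C c))

theorem norm_prepareReceivers_apply {φ : ∀ c, Hil (P c)} (hφ : ∀ c, ‖φ c‖ = 1) :
    ∀ i v, ‖prepareReceivers L A R C φ i v‖ = ‖v‖
  | .inl _, _ => rfl
  | .inr (.inl _), _ => rfl
  | .inr (.inr c), v => norm_attach_apply (hφ c) v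

/-- Forgetting the reference systems of the receivers in a basis label. -/
def forgetReceivers (y : ∀ i, SysOut L A R P C i) : ∀ i, SysOut L A R (fun _ : γ => Unit) C i
  | .inl a => y (.inl a)
  | .inr (.inl b) => y (.inr (.inl b))
  | .inr (.inr c) => ((), (y (.inr (.inr c))).2)

/-- Forgetting the reference systems of the receivers in a product of vectors. -/
def forgetReceiverVectors (φ : ∀ i, Hil (SysIn L A' R B P i)) :
    ∀ i, Hil (SysIn L A' R B (fun _ : γ => Unit) i)
  | .inl a => φ (.inl a)
  | .inr (.inl b) => φ (.inr (.inl b))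
  | .inr (.inr _) => (ket () : Hil Unit)

theorem norm_forgetReceiverVectors {φ : ∀ i, Hil (SysIn L A' R B P i)} (hφ : ∀ i, ‖φ i‖ = 1) :
    ∀ i, ‖forgetReceiverVectors φ i‖ = 1
  | .inl a => hφ (.inl a)
  | .inr (.inl b) => hφ (.inr (.inl b))
  | .inr (.inr _) => norm_ket ()

variable [Fintype α] [Fintype β] [Fintype γ]

theorem tensorOp_prepareReceivers_apply (φ : ∀ c, Hil (P c))
    (g : Hil (∀ i, SysOut L A R (fun _ : γ => Unit) C i)) (y : ∀ i, SysOut L A R P C i) :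
    tensorOp (prepareReceivers L A R C φ) g y
      = (∏ c, φ c (y (.inr (.inr c))).1) * g (forgetReceivers y) := by
  classical
  refine (hasSum_apply _ g y).unique ?_
  have e : g (forgetReceivers y) * entry (tensorOp (prepareReceivers L A R C φ)) y
      (forgetReceivers y) = (∏ c, φ c (y (.inr (.inr c))).1) * g (forgetReceivers y) := by
    rw [entry_tensorOp, Fintype.prod_sum_type, Fintype.prod_sum_type, mul_comm]
    congr 1
    have h1 : ∀ a, entry (prepareReceivers L A R C φ (.inl a)) (y (.inl a))
        (forgetReceivers y (.inl a)) = 1 := fun a =>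
      (ket_apply (X := L a × A a) _ _).trans (if_pos rfl)
    have h2 : ∀ b, entry (prepareReceivers L A R C φ (.inr (.inl b))) (y (.inr (.inl b)))
        (forgetReceivers y (.inr (.inl b))) = 1 := fun b =>
      (ket_apply (X := R b) _ _).trans (if_pos rfl)
    have h3 : ∀ c, entry (prepareReceivers L A R C φ (.inr (.inr c))) (y (.inr (.inr c)))
        (forgetReceivers y (.inr (.inr c))) = φ c (y (.inr (.inr c))).1 := fun c =>
      (entry_attach (φ c) _ _).trans (if_pos rfl)
    simp only [h1, h2, h3, Finset.prod_const_one, one_mul]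
  rw [← e]
  refine hasSum_single _ fun x hx => ?_
  obtain ⟨i, hi⟩ := Function.ne_iff.1 hx
  rw [entry_tensorOp, Finset.prod_eq_zero (Finset.mem_univ i), mul_zero]
  rcases i with a | b | c
  · exact (ket_apply (X := L a × A a) _ _).trans (if_neg (Ne.symm hi))
  · exact (ket_apply (X := R b) _ _).trans (if_neg (Ne.symm hi))
  · refine (entry_attach (φ c) _ _).trans (if_neg fun h => hi ?_)
    exact Prod.ext rfl h.symm

theorem hil_ext {f g : Hil X} (h : ∀ x, f x = g x) : f = g :=
  lp.ext (funext h)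

theorem withReferences_prodVec (N : MultiplexKraus κ A' B A C) (k : κ)
    (φ : ∀ i, Hil (SysIn L A' R B P i)) :
    withReferences N L R P k (prodVec φ)
      = tensorOp (prepareReceivers (P := P) L A R C fun c => φ (.inr (.inr c)))
        (withReferences N L R (fun _ => Unit) k (prodVec (forgetReceiverVectors φ))) := by
  refine hil_ext fun y => ?_
  refine Eq.trans ?_ (tensorOp_prepareReceivers_apply (P := P) _ _ y).symm
  rw [withReferences_apply, withReferences_apply]
  rw [← smul_eq_mul, ← Pi.smul_apply, ← lp.coeFn_smul, ← map_smul]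
  refine congrArg (fun f => N k f (splitOut L A R P C y).2) ?_
  refine hil_ext fun w => ?_
  rw [lp.coeFn_smul, Pi.smul_apply, pull_apply, pull_apply, prodVec_apply, prodVec_apply,
    Fintype.prod_sum_type, Fintype.prod_sum_type, Fintype.prod_sum_type, Fintype.prod_sum_type]
  have h : ∀ c : γ, forgetReceiverVectors φ (.inr (.inr c))
      ((splitIn L A' R B fun _ => Unit).symm
        ((splitOut L A R (fun _ => Unit) C (forgetReceivers y)).1, w) (.inr (.inr c))) = 1 := by
    intro c
    exact (ket_apply () ()).trans (if_pos rfl)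
  simp only [h, Finset.prod_const_one, mul_one, smul_eq_mul]
  have hr : ∀ a b c : ℂ, a * (b * c) = c * (a * b) := fun a b c => by ring
  exact hr _ _ _

end Attach

/-! ### One-use protocols -/

section Protocol

variable {α β γ κ : Type} [Fintype α] [Fintype β] [Fintype γ]
  {A' : α → Type} {B : β → Type} {A : α → Type} {C : γ → Type}

theorem prodVec_isFullyProduct {ι : Type} [Fintype ι] {W : ι → Type} (φ : ∀ i, Hil (W i)) :
    IsFullyProduct (prodVec φ) := ⟨φ, prodVec_apply φ⟩

/-- The key size of a protocol is bounded by the entanglement generated from a pure input. -/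
theorem IsOneUseProtocol.exists_pure {N : MultiplexKraus κ A' B A C} (hN : IsChannel N) {K : ℕ}
    {ε : ℝ} (h : IsOneUseProtocol N K ε) :
    ∃ (L : α → Type) (R : β → Type), (∀ a, Countable (L a)) ∧ (∀ b, Countable (R b)) ∧
      ∃ ψ ∈ FS (SysIn L A' R B fun _ : γ => Unit), IsPure ψ ∧
        ((Real.logb 2 K : ℝ) : EReal)
          ≤ stateEhGE ε (applyKraus (withReferences N L R fun _ => Unit) ψ) := by
  obtain ⟨-, L, R, P, S, hL, hR, -, -, ρ, ⟨p, φ, hp, hp1, hφ, hρ⟩, D, hD, priv, hpriv, hF⟩ := h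
  have hpure : ∀ n, ∃ Φ : ∀ i, Hil (SysIn L A' R B P i), (∀ i, ‖Φ i‖ = 1) ∧ φ n = prodVec Φ :=
    fun n => (hφ n).2.exists_unit (hφ n).1
  have hfs : ∀ Φ : ∀ i, Hil (SysIn L A' R B P i), (∀ i, ‖Φ i‖ = 1) →
      proj (prodVec (forgetReceiverVectors Φ)) ∈ FS (SysIn L A' R B fun _ : γ => Unit) ∧
      IsPure (proj (prodVec (forgetReceiverVectors Φ))) := by
    intro Φ hΦ
    have hn := norm_prodVec (norm_forgetReceiverVectors hΦ)
    exact ⟨isMixtureOf_proj hn (prodVec_isFullyProduct _), _, hn, rfl⟩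
  refine ⟨L, R, hL, hR, ?_⟩
  rcases isEmpty_or_nonempty (α ⊕ β ⊕ γ) with hι | hι
  · obtain ⟨Φ, hΦ, -⟩ := hpure 0
    refine ⟨_, (hfs Φ hΦ).1, (hfs Φ hΦ).2, ?_⟩
    unfold stateEhGE
    refine le_iInf₂ fun σ hσ => ?_
    obtain ⟨v, -, hv⟩ := exists_isEnsemble_of_mem_BS hσ
    obtain ⟨I, ⟨i, -⟩, -⟩ := hv 0
    exact hι.elim i
  obtain ⟨U, ω, hU, hω, rfl⟩ := hpriv.exists_isometry
  have hV := norm_adjoint_privateIsometry_le_norm (U := U) hU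
  set V := privateIsometry U with hVdef
  have hNr := hN.withReferences L R P
  have e1 := IsMixtureOf.isEnsemble hp hp1 hφ hρ
  have e3 := (e1.applyKraus hNr).applyKraus hD.2
  have hT := (hD.2.comp hNr).comp_contraction hV
  obtain ⟨Λ₀, -, -, hΛ₀⟩ := exists_test hT
  obtain ⟨n, hn⟩ : ∃ n, 1 - ε ≤ (inner ℂ (φ n) (Λ₀ (φ n))).re := by
    have hsum := Summable.of_nonneg_of_le (fun _ => by positivity)
      (fun q => pow_le_pow_left₀ (norm_nonneg _) (hV _) 2) e3.norm_sq.summable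
    have hle := hF.trans (fidelity_le_hasSum hω e3 hsum.hasSum)
    refine exists_le_of_hasSum_mul hp hp1 ?_ hle
    have h1 := (((Equiv.prodComm _ _).trans (Equiv.prodAssoc _ _ _)).hasSum_iff).2 hsum.hasSum
    refine h1.prod_fiberwise fun n => ?_
    refine ((hΛ₀ (φ n)).mul_left (p n)).congr_fun fun q => ?_
    simp only [Function.comp_apply, Equiv.trans_apply, Equiv.prodComm_apply, Prod.swap_prod_mk,
      Equiv.prodAssoc_apply, map_smul, ContinuousLinearMap.comp_apply, norm_smul,
      Complex.norm_real, Real.norm_eq_abs, mul_pow, sq_abs, Real.sq_sqrt (hp n)]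
  obtain ⟨Φ, hΦ, hn'⟩ := hpure n
  refine ⟨_, (hfs Φ hΦ).1, (hfs Φ hΦ).2, ?_⟩
  set J := tensorOp (prepareReceivers (P := P) L A R C fun c => Φ (.inr (.inr c))) with hJdef
  have hJ : ∀ v, ‖J v‖ = ‖v‖ := norm_tensorOp_apply (norm_prepareReceivers_apply fun c => hΦ _)
  have hDJ : IsChannel fun d => loccKraus D d ∘L J := by
    intro v
    have := hD.2 (J v)
    rwa [hJ] at this
  obtain ⟨Λ, hΛ0, hΛ1, hΛ⟩ := exists_test (hDJ.comp_contraction hV)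
  refine le_stateEhGE_of_test hΛ0 hΛ1 (hn.trans (le_of_eq ?_)) fun σ hσ => ?_
  · set ψ := prodVec (forgetReceiverVectors Φ) with hψ
    have e4 := ((isEnsemble_proj ψ).applyKraus (hN.withReferences L R fun _ => Unit)).tr_eq Λ
    have e5 := (Equiv.prodPUnit κ).symm.hasSum_iff.2 e4
    refine HasSum.unique ?_ e5
    refine ((Equiv.prodComm _ _).hasSum_iff.2 (hΛ₀ (φ n))).prod_fiberwise fun k => ?_
    refine (hΛ _).congr_fun fun d => ?_
    simp only [Function.comp_apply, Equiv.prodComm_apply, Prod.swap_prod_mk,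
      ContinuousLinearMap.comp_apply, hn', withReferences_prodVec N k Φ]
    rfl
  · obtain ⟨v, hv, hb⟩ := exists_isEnsemble_of_mem_BS hσ
    have h1 : ∀ m, (inner ℂ (v m) (Λ (v m))).re ≤ (K : ℝ)⁻¹ * ‖v m‖ ^ 2 := by
      intro m
      refine hasSum_le (fun d => ?_) (hΛ (v m)) ((hDJ (v m)).mul_left _)
      exact norm_sq_adjoint_privateIsometry_le hU
        (((hb m).tensorOp _).tensorOp fun i => D d.1 i (d.2 i))
    have := hasSum_le h1 (hv.tr_eq Λ) (hv.norm_sq.mul_left _)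
    rwa [mul_one] at this

end Protocol

/-! ### Convex mixtures -/

section Mixtures

variable {X Y : Type}

theorem hasSum_sumElim {M : Type} [AddCommMonoid M] [TopologicalSpace M] [ContinuousAdd M]
    {I J : Type} {f : I → M} {g : J → M} {a b : M} (hf : HasSum f a) (hg : HasSum g b) :
    HasSum (Sum.elim f g) (a + b) := by
  have h := HasSum.add_isCompl (s := Set.range (Sum.inl : I → I ⊕ J)) (t := Set.range Sum.inr)
    Set.isCompl_range_inl_range_inr (f := Sum.elim f g)
    (Sum.inl_injective.hasSum_range_iff.2 hf) (Sum.inr_injective.hasSum_range_iff.2 hg)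
  exact h

theorem real_smul_hil (c : ℝ) (v : Hil X) : c • v = (c : ℂ) • v :=
  hil_ext fun x => by
    change c • v x = (c : ℂ) • v x
    exact Complex.real_smul

theorem real_smul_op (c : ℝ) (T : Op X Y) : c • T = (c : ℂ) • T :=
  ContinuousLinearMap.ext fun v => real_smul_hil c (T v)

theorem convex_isMixtureOf (Q : Hil X → Prop) : Convex ℝ {ρ | IsMixtureOf Q ρ} := by
  rintro ρ₁ ⟨p₁, ψ₁, hp₁, h₁, hψ₁, hρ₁⟩ ρ₂ ⟨p₂, ψ₂, hp₂, h₂, hψ₂, hρ₂⟩ a b ha hb hab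
  let e := Equiv.natSumNatEquivNat.symm
  refine ⟨Sum.elim (fun n => a * p₁ n) (fun n => b * p₂ n) ∘ e, Sum.elim ψ₁ ψ₂ ∘ e, fun n => ?_, ?_,
    fun n => ?_, ?_⟩
  · rw [Function.comp_apply]
    rcases e n with k | k
    · exact mul_nonneg ha (hp₁ k)
    · exact mul_nonneg hb (hp₂ k)
  · rw [e.hasSum_iff, ← hab]
    simpa using hasSum_sumElim (h₁.mul_left a) (h₂.mul_left b)
  · rw [Function.comp_apply]
    rcases e n with k | k
    · exact hψ₁ k
    · exact hψ₂ k
  · have h := e.hasSum_iff.2 (hasSum_sumElim (hρ₁.const_smul a) (hρ₂.const_smul b))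
    refine h.congr_fun fun n => ?_
    simp only [Function.comp_apply]
    rcases e n with k | k
    · simp only [Sum.elim_inl, Complex.ofReal_mul, mul_smul, real_smul_op]
    · simp only [Sum.elim_inr, Complex.ofReal_mul, mul_smul, real_smul_op]

/-- Operators that are sums of rank-one operators of total weight one. -/
def IsState (ρ : Op X X) : Prop :=
  ∃ (J : Type) (v : J → Hil X), IsEnsemble v 1 ρ

theorem IsState.tr_nonneg {ρ : Op X X} (h : IsState ρ) {Λ : Op X X} (hΛ : 0 ≤ Λ) :
    0 ≤ (tr (Λ ∘L ρ)).re :=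
  let ⟨_, _, hv⟩ := h
  hv.tr_nonneg hΛ

theorem IsState.tr_one {ρ : Op X X} (h : IsState ρ) : (tr ((1 : Op X X) ∘L ρ)).re = 1 :=
  let ⟨_, _, hv⟩ := h
  hv.tr_one

theorem IsState.tr_comb {ρ : Op X X} (h : IsState ρ) (a b : ℝ) (Λ Λ' : Op X X) :
    (tr ((a • Λ + b • Λ') ∘L ρ)).re = a * (tr (Λ ∘L ρ)).re + b * (tr (Λ' ∘L ρ)).re := by
  obtain ⟨J, v, hv⟩ := h
  refine (hv.tr_eq _).unique ?_
  refine (((hv.tr_eq Λ).mul_left a).add ((hv.tr_eq Λ').mul_left b)).congr_fun fun j => ?_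
  simp only [add_apply, smul_apply, inner_add_right, Complex.add_re]
  rw [real_smul_hil, real_smul_hil, inner_smul_right, inner_smul_right,
    Complex.re_ofReal_mul, Complex.re_ofReal_mul]

theorem IsState.tr_le_one {ρ : Op X X} (h : IsState ρ) {Λ : Op X X} (hΛ : Λ ≤ 1) :
    (tr (Λ ∘L ρ)).re ≤ 1 := by
  have h1 := h.tr_nonneg (sub_nonneg.2 hΛ)
  have h2 := h.tr_comb 1 (-1) 1 Λ
  rw [h.tr_one, one_smul, neg_one_smul, ← sub_eq_add_neg] at h2
  linarith

theorem tr_comp_sum {m : ℕ} {σ : Fin m → Op X X} (hσ : ∀ i, IsState (σ i)) (q : Fin m → ℝ)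
    (Λ : Op X X) :
    (tr (Λ ∘L ∑ i, q i • σ i)).re = ∑ i, q i * (tr (Λ ∘L σ i)).re := by
  have h : ∀ i, HasSum (fun x => entry (Λ ∘L σ i) x x) (tr (Λ ∘L σ i)) := by
    intro i
    obtain ⟨J, v, hv⟩ := hσ i
    exact (hv.hasSum_trace Λ).2.summable.hasSum
  have h3 : HasSum (fun x => entry (Λ ∘L ∑ i, q i • σ i) x x) (∑ i, q i * tr (Λ ∘L σ i)) := by
    refine (hasSum_sum fun i _ => (h i).mul_left (q i : ℂ)).congr_fun fun x => ?_
    simp only [entry, ContinuousLinearMap.comp_apply, sum_apply, smul_apply, map_sum]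
    rw [lp.coeFn_sum, Finset.sum_apply]
    refine Finset.sum_congr rfl fun i _ => ?_
    rw [real_smul_hil, map_smul]
    rfl
  have h4 : tr (Λ ∘L ∑ i, q i • σ i) = ∑ i, q i * tr (Λ ∘L σ i) := h3.tsum_eq
  rw [h4, Complex.re_sum]
  exact Finset.sum_congr rfl fun i _ => Complex.re_ofReal_mul _ _

theorem isState_of_mem_BS {ι : Type} {W : ι → Type} {σ : Op (∀ i, W i) (∀ i, W i)}
    (hσ : σ ∈ BS W) : IsState σ :=
  let ⟨v, hv, _⟩ := exists_isEnsemble_of_mem_BS hσ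
  ⟨ℕ, v, hv⟩

/-- If every vector of a convex set has a coordinate of size at least `c`, then some average of the
coordinates is at least `c` on the whole set. -/
theorem exists_weights {m : ℕ} {V : Set (Fin m → ℝ)} (hV : Convex ℝ V) (hne : V.Nonempty) {c : ℝ}
    (h : ∀ v ∈ V, ∃ i, c ≤ v i) :
    ∃ q : Fin m → ℝ, (∀ i, 0 ≤ q i) ∧ ∑ i, q i = 1 ∧ ∀ v ∈ V, c ≤ ∑ i, q i * v i := by
  let O : Set (Fin m → ℝ) := Set.pi Set.univ fun _ => Set.Iio c
  have hO : IsOpen O := isOpen_set_pi Set.finite_univ fun _ _ => isOpen_Iio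
  have hOc : Convex ℝ O := convex_pi fun _ _ => convex_Iio c
  have hd : Disjoint O V := by
    rw [Set.disjoint_left]
    intro v hvO hvV
    obtain ⟨i, hi⟩ := h v hvV
    exact absurd (hvO i (Set.mem_univ i)) (not_lt.2 hi)
  obtain ⟨f, u, hfO, hfV⟩ := geometric_hahn_banach_open hOc hO hV hd
  let q : Fin m → ℝ := fun i => f (Pi.single i 1)
  have hf : ∀ v, f v = ∑ i, q i * v i := by
    intro v
    conv_lhs => rw [← Finset.univ_sum_single v, map_sum]
    refine Finset.sum_congr rfl fun i _ => ?_
    have : (Pi.single i (v i) : Fin m → ℝ) = v i • Pi.single i (1 : ℝ) := by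
      rw [← Pi.single_smul]; simp
    rw [this, map_smul, smul_eq_mul, mul_comm]
  have hδ : ∀ δ > 0, c * ∑ i, q i - δ * ∑ i, q i < u := by
    intro δ hδ
    have := hfO (fun _ => c - δ) fun i _ => by simp [hδ]
    rw [hf, ← Finset.sum_mul] at this
    linarith
  have hq : ∀ i, 0 ≤ q i := by
    intro i
    by_contra! hi
    have hlow : ∀ s : ℝ, 0 ≤ s → (∑ j, q j) * (c - 1) - s * q i < u := by
      intro s hs
      have := hfO ((fun _ => c - 1) - s • Pi.single i (1 : ℝ)) fun j _ => by
        simp only [Pi.sub_apply, Pi.smul_apply, smul_eq_mul, Set.mem_Iio]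
        rcases eq_or_ne j i with rfl | hj
        · simp; linarith
        · simp [hj]
      rw [map_sub, map_smul, hf, ← Finset.sum_mul] at this
      exact this
    have h0 := hlow 0 le_rfl
    have h1 := hlow ((u - (∑ j, q j) * (c - 1)) / (-q i))
      (div_nonneg (by linarith) (by linarith))
    have h2 : (u - (∑ j, q j) * (c - 1)) / (-q i) * q i = -(u - (∑ j, q j) * (c - 1)) := by
      rw [div_mul_eq_mul_div, div_neg, mul_div_assoc, div_self hi.ne, mul_one]
    rw [h2] at h1
    linarith
  have hu : c * ∑ i, q i ≤ u := by
    have hs : 0 ≤ ∑ i, q i := Finset.sum_nonneg fun i _ => hq i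
    refine le_of_forall_pos_le_add fun η hη => ?_
    have h1 := hδ (η / (∑ i, q i + 1)) (by positivity)
    have h2 : η / (∑ i, q i + 1) * ∑ i, q i ≤ η := by
      rw [div_mul_eq_mul_div, div_le_iff₀ (by positivity)]
      nlinarith
    linarith
  have hpos : 0 < ∑ i, q i := by
    refine (Finset.sum_nonneg fun i _ => hq i).lt_of_ne' fun h0 => ?_
    have hz : ∀ i, q i = 0 := fun i =>
      (Finset.sum_eq_zero_iff_of_nonneg fun i _ => hq i).1 h0 i (Finset.mem_univ i)
    obtain ⟨v, hv⟩ := hne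
    have h1 := hfV v hv
    have h2 := hδ 1 one_pos
    rw [hf] at h1
    simp only [hz, zero_mul, Finset.sum_const_zero, mul_zero, sub_zero] at h1 h2
    linarith
  refine ⟨fun i => q i / ∑ j, q j, fun i => div_nonneg (hq i) hpos.le, ?_, fun v hv => ?_⟩
  · rw [← Finset.sum_div, div_self hpos.ne']
  · have h1 := hu.trans (hfV v hv)
    rw [hf] at h1
    simp only [div_mul_eq_mul_div]
    rw [← Finset.sum_div, le_div_iff₀ hpos]
    exact h1

/-- Truncating a mixture: a test that accepts the mixture accepts one of finitely many terms. -/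
theorem exists_truncation {p : ℕ → ℝ} (hp : ∀ n, 0 ≤ p n) (h1 : HasSum p 1) {ε η : ℝ} (hη : 0 < η)
    (hεη : ε + η ≤ 1) : ∃ m, ∀ (a : ℕ → ℝ) (s : ℝ), (∀ n, a n ≤ 1) →
      HasSum (fun n => p n * a n) s → 1 - ε ≤ s → ∃ n < m, 1 - ε - η ≤ a n := by
  obtain ⟨m, hm⟩ := (h1.tendsto_sum_nat.eventually (lt_mem_nhds (show 1 - η < 1 by linarith))).exists
  refine ⟨m, fun a s ha hs hε => ?_⟩
  by_contra! hlt
  have hd := sum_le_hasSum (Finset.range m)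
    (fun n _ => sub_nonneg.2 (mul_le_of_le_one_right (hp n) (ha n))) (h1.sub hs)
  rw [Finset.sum_sub_distrib] at hd
  have h2 : ∑ n ∈ Finset.range m, p n * a n ≤ ∑ n ∈ Finset.range m, p n * (1 - ε - η) :=
    Finset.sum_le_sum fun n hn =>
      mul_le_mul_of_nonneg_left (hlt n (Finset.mem_range.1 hn)).le (hp n)
  rw [← Finset.sum_mul] at h2
  have h3 := mul_le_mul_of_nonneg_right (sum_le_hasSum (Finset.range m) (fun n _ => hp n) h1)
    (show 0 ≤ 1 - ε - η by linarith)
  linarith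

theorem lt_optimalError_of_lt {ε r : ℝ} {ρ σ : Op X X}
    (h : hypothesisTestingDivergence ε ρ σ < (r : EReal)) : (2 : ℝ) ^ (-r) < optimalError ε ρ σ := by
  unfold hypothesisTestingDivergence at h
  split_ifs at h with h0
  · exact absurd h (not_lt.2 le_top)
  · rw [EReal.coe_lt_coe_iff, neg_lt] at h
    exact (Real.lt_logb_iff_rpow_lt (by norm_num) (not_le.1 h0)).1 h

theorem divergence_le_of_le_optimalError {ε r : ℝ} {ρ σ : Op X X}
    (h : (2 : ℝ) ^ (-r) ≤ optimalError ε ρ σ) : hypothesisTestingDivergence ε ρ σ ≤ (r : EReal) := by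
  have h0 : 0 < optimalError ε ρ σ := lt_of_lt_of_le (by positivity) h
  unfold hypothesisTestingDivergence
  rw [if_neg (not_le.2 h0), EReal.coe_le_coe_iff, neg_le]
  exact (Real.le_logb_iff_rpow_le (by norm_num) h0).2 h

theorem optimalError_le {ε : ℝ} {ρ σ Λ : Op X X} (hσ : IsState σ) (h0 : 0 ≤ Λ) (h1 : Λ ≤ 1)
    (hρ : 1 - ε ≤ (tr (Λ ∘L ρ)).re) : optimalError ε ρ σ ≤ (tr (Λ ∘L σ)).re := by
  have hmem : (tr (Λ ∘L σ)).re ∈ {t : ℝ | ∃ Λ' : Op X X, 0 ≤ Λ' ∧ Λ' ≤ 1 ∧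
      1 - ε ≤ (tr (Λ' ∘L ρ)).re ∧ t = (tr (Λ' ∘L σ)).re} := ⟨Λ, h0, h1, hρ, rfl⟩
  refine csInf_le ⟨0, ?_⟩ hmem
  rintro t ⟨Λ', h0', -, -, rfl⟩
  exact hσ.tr_nonneg h0'

theorem test_comb {a b : ℝ} (ha : 0 ≤ a) (hb : 0 ≤ b) (hab : a + b = 1) {Λ Λ' : Op X X}
    (h0 : 0 ≤ Λ) (h1 : Λ ≤ 1) (h0' : 0 ≤ Λ') (h1' : Λ' ≤ 1) :
    0 ≤ a • Λ + b • Λ' ∧ a • Λ + b • Λ' ≤ 1 := by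
  have hs : ∀ {c : ℝ} {T : Op X X}, 0 ≤ c → 0 ≤ T → 0 ≤ c • T := by
    intro c T hc hT
    rw [real_smul_op]
    rw [ContinuousLinearMap.nonneg_iff_isPositive] at hT ⊢
    exact hT.smul_of_nonneg (by exact_mod_cast hc)
  refine ⟨add_nonneg (hs ha h0) (hs hb h0'), ?_⟩
  have e : (1 : Op X X) - (a • Λ + b • Λ') = a • (1 - Λ) + b • (1 - Λ') := by
    conv_lhs => rw [← one_smul ℝ (1 : Op X X), ← hab, add_smul]
    rw [smul_sub, smul_sub]
    abel
  rw [← sub_nonneg, e]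
  exact add_nonneg (hs ha (sub_nonneg.2 h1)) (hs hb (sub_nonneg.2 h1'))

/-- The entanglement of a mixture is at most the largest entanglement of its terms. -/
theorem stateEhGE_le_of_mixture {ι : Type} {W : ι → Type} {ε : ℝ} (hε0 : 0 < ε) (hε1 : ε < 1)
    {p : ℕ → ℝ} (hp : ∀ n, 0 ≤ p n) (h1 : HasSum p 1) {ρ : Op (∀ i, W i) (∀ i, W i)}
    {τ : ℕ → Op (∀ i, W i) (∀ i, W i)} (hρ : IsState ρ) (hτ : ∀ n, IsState (τ n))
    (hmix : ∀ Λ, HasSum (fun n => p n * (tr (Λ ∘L τ n)).re) (tr (Λ ∘L ρ)).re)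
    {s : EReal} (hs : ∀ n, stateEhGE ε (τ n) ≤ s) : stateEhGE ε ρ ≤ s := by
  rw [← EReal.le_of_forall_lt_iff_le]
  intro r hr
  obtain ⟨r', hsr', hr'r⟩ := EReal.lt_iff_exists_real_btwn.1 hr
  have hrr : r' < r := EReal.coe_lt_coe_iff.1 hr'r
  have hex : ∀ n, ∃ σ ∈ BS W, hypothesisTestingDivergence ε (τ n) σ < (r' : EReal) := by
    intro n
    have := (hs n).trans_lt hsr'
    unfold stateEhGE at this
    simpa only [iInf_lt_iff, exists_prop] using this
  choose σ hσ hσr using hex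
  have hσs : ∀ n, IsState (σ n) := fun n => isState_of_mem_BS (hσ n)
  have hc : (2 : ℝ) ^ (-r) < (2 : ℝ) ^ (-r') :=
    Real.rpow_lt_rpow_of_exponent_lt (by norm_num) (neg_lt_neg hrr)
  set c := (2 : ℝ) ^ (-r')
  set c' := (2 : ℝ) ^ (-r) with hc'
  obtain ⟨t, ht0, ht1, htc, htε⟩ : ∃ t : ℝ, 0 < t ∧ t ≤ 1 ∧ t ≤ c - c' ∧ ε + t * ε ≤ 1 := by
    refine ⟨min (min 1 (c - c')) ((1 - ε) / ε), ?_, ?_, ?_, ?_⟩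
    · exact lt_min (lt_min one_pos (sub_pos.2 hc)) (div_pos (sub_pos.2 hε1) hε0)
    · exact (min_le_left _ _).trans (min_le_left _ _)
    · exact (min_le_left _ _).trans (min_le_right _ _)
    · have := (le_div_iff₀ hε0).1 (min_le_right (min 1 (c - c')) ((1 - ε) / ε))
      linarith
  obtain ⟨m, hm⟩ := exists_truncation hp h1 (mul_pos ht0 hε0) htε
  let V : Set (Fin m → ℝ) := {v | ∃ Λ : Op (∀ i, W i) (∀ i, W i), 0 ≤ Λ ∧ Λ ≤ 1 ∧
    1 - ε ≤ (tr (Λ ∘L ρ)).re ∧ v = fun i : Fin m => (tr (Λ ∘L σ i)).re}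
  have hone : (0 : Op (∀ i, W i) (∀ i, W i)) ≤ 1 := by
    rw [ContinuousLinearMap.nonneg_iff_isPositive]
    exact ContinuousLinearMap.isPositive_one
  have hone' : 1 - ε ≤ (tr ((1 : Op (∀ i, W i) (∀ i, W i)) ∘L ρ)).re := by
    rw [hρ.tr_one]; linarith
  have hVc : Convex ℝ V := by
    rintro _ ⟨Λ, hΛ0, hΛ1, hΛ, rfl⟩ _ ⟨Λ', hΛ0', hΛ1', hΛ', rfl⟩ a b ha hb hab
    obtain ⟨h, h'⟩ := test_comb ha hb hab hΛ0 hΛ1 hΛ0' hΛ1'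
    refine ⟨_, h, h', ?_, funext fun i => ?_⟩
    · rw [hρ.tr_comb]
      have e : 1 - ε = a * (1 - ε) + b * (1 - ε) := by rw [← add_mul, hab, one_mul]
      rw [e]
      exact add_le_add (mul_le_mul_of_nonneg_left hΛ ha) (mul_le_mul_of_nonneg_left hΛ' hb)
    · rw [(hσs i).tr_comb]
      rfl
  have hVm : ∀ v ∈ V, ∃ i, c' ≤ v i := by
    rintro _ ⟨Λ, hΛ0, hΛ1, hΛ, rfl⟩
    obtain ⟨n, hn, hna⟩ := hm _ _ (fun n => (hτ n).tr_le_one hΛ1) (hmix Λ) hΛ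
    refine ⟨⟨n, hn⟩, ?_⟩
    obtain ⟨h, h'⟩ := test_comb (sub_nonneg.2 ht1) ht0.le (sub_add_cancel 1 t) hΛ0 hΛ1 hone le_rfl
    have h2 := optimalError_le (ε := ε) (ρ := τ n) (hσs n) h h' (by
      rw [(hτ n).tr_comb, (hτ n).tr_one]
      nlinarith [mul_le_mul_of_nonneg_left hna (sub_nonneg.2 ht1), mul_pos ht0 hε0,
        mul_pos ht0 (mul_pos ht0 hε0)])
    rw [(hσs n).tr_comb, (hσs n).tr_one] at h2
    have h3 := lt_optimalError_of_lt (hσr n)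
    have h4 := (hσs n).tr_nonneg hΛ0
    change c' ≤ (tr (Λ ∘L σ n)).re
    nlinarith [mul_nonneg ht0.le h4]
  obtain ⟨q, hq0, hq1, hq⟩ := exists_weights hVc ⟨_, 1, hone, le_rfl, hone', rfl⟩ hVm
  have hσm : ∑ i, q i • σ i ∈ BS W :=
    (convex_isMixtureOf IsBiproduct).sum_mem (fun i _ => hq0 i) hq1 fun i _ => hσ i
  refine (iInf₂_le _ hσm).trans (divergence_le_of_le_optimalError ?_)
  unfold optimalError
  refine le_csInf ⟨_, 1, hone, le_rfl, hone', rfl⟩ ?_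
  rintro _ ⟨Λ, hΛ0, hΛ1, hΛ, rfl⟩
  rw [tr_comp_sum fun i : Fin m => hσs i]
  exact hq _ ⟨Λ, hΛ0, hΛ1, hΛ, rfl⟩

theorem hasSum_tr_applyKraus {κ : Type} {V : κ → Op X Y} (hV : IsChannel V) {Q : Hil X → Prop}
    {p : ℕ → ℝ} {ψ : ℕ → Hil X} {ρ : Op X X} (hp : ∀ n, 0 ≤ p n) (h1 : HasSum p 1)
    (hψ : ∀ n, ‖ψ n‖ = 1 ∧ Q (ψ n)) (h : HasSum (fun n => (p n : ℂ) • proj (ψ n)) ρ)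
    (Λ : Op Y Y) :
    HasSum (fun n => p n * (tr (Λ ∘L applyKraus V (proj (ψ n)))).re)
      (tr (Λ ∘L applyKraus V ρ)).re := by
  have h2 := ((IsMixtureOf.isEnsemble hp h1 hψ h).applyKraus hV).tr_eq Λ
  refine ((Equiv.prodComm ℕ κ).hasSum_iff.2 h2).prod_fiberwise fun n => ?_
  have h3 := (Equiv.prodPUnit κ).symm.hasSum_iff.2
    (((isEnsemble_proj (ψ n)).applyKraus hV).tr_eq Λ)
  refine (h3.mul_left (p n)).congr_fun fun k => ?_
  simp only [Function.comp_apply, Equiv.prodComm_apply, Prod.swap_prod_mk, map_smul,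
    inner_smul_left, inner_smul_right, Complex.conj_ofReal, Equiv.prodPUnit_symm_apply]
  rw [Complex.re_ofReal_mul, Complex.re_ofReal_mul, ← mul_assoc, Real.mul_self_sqrt (hp n)]

end Mixtures

section Rates

variable {α β γ κ : Type} [Fintype α] [Fintype β] [Fintype γ]
  {A' : α → Type} {B : β → Type} {A : α → Type} {C : γ → Type}

theorem pureChannelEhGE_le (N : MultiplexKraus κ A' B A C) (ε : ℝ) :
    pureChannelEhGE N ε ≤ channelEhGE N ε := by
  refine sSup_le_sSup ?_
  rintro e ⟨L, R, hL, hR, ψ, hψ, -, he⟩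
  exact ⟨L, R, hL, hR, ψ, hψ, he⟩

theorem channelEhGE_eq_pure {N : MultiplexKraus κ A' B A C} (hN : IsChannel N) {ε : ℝ}
    (hε0 : 0 < ε) (hε1 : ε < 1) : channelEhGE N ε = pureChannelEhGE N ε := by
  refine le_antisymm (sSup_le ?_) (pureChannelEhGE_le N ε)
  rintro _ ⟨L, R, hL, hR, ψ, ⟨p, φ, hp, h1, hφ, hψ⟩, rfl⟩
  have hV := hN.withReferences L R fun _ : γ => Unit
  refine stateEhGE_le_of_mixture hε0 hε1 hp h1
    ⟨_, _, (IsMixtureOf.isEnsemble hp h1 hφ hψ).applyKraus hV⟩ (fun n => ?_)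
    (hasSum_tr_applyKraus hV hp h1 hφ hψ) fun n => le_sSup ?_
  · have h := (isEnsemble_proj (φ n)).applyKraus hV
    rw [(hφ n).1, one_pow] at h
    exact ⟨_, _, h⟩
  · exact ⟨L, R, hL, hR, proj (φ n), isMixtureOf_proj (hφ n).1 (hφ n).2, ⟨_, (hφ n).1, rfl⟩, rfl⟩

theorem IsOneUseProtocol.logb_le {N : MultiplexKraus κ A' B A C} (hN : IsChannel N) {K : ℕ} {ε : ℝ}
    (h : IsOneUseProtocol N K ε) : ((Real.logb 2 K : ℝ) : EReal) ≤ channelEhGE N ε := by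
  obtain ⟨L, R, hL, hR, ψ, hψ, -, hle⟩ := h.exists_pure hN
  exact hle.trans (le_sSup ⟨L, R, hL, hR, ψ, hψ, rfl⟩)

end Rates

end CKA

end

theorem mainTheorem2 {α β γ κ : Type} [Fintype α] [Fintype β] [Fintype γ] [Countable κ]
    {A' : α → Type} {B : β → Type} {A : α → Type} {C : γ → Type}
    [∀ a, Countable (A' a)] [∀ b, Countable (B b)] [∀ a, Countable (A a)] [∀ c, Countable (C c)]
    (N : CKA.MultiplexKraus κ A' B A C) (hN : CKA.IsChannel N)
    (ε : ℝ) (hε : ε ∈ Set.Ioo (0 : ℝ) 1) :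
    CKA.oneShotRate N ε ≤ CKA.channelEhGE N ε ∧
    CKA.channelEhGE N ε = CKA.pureChannelEhGE N ε ∧
    ∀ n : ℕ, 0 < n →
      CKA.nShotRate N n ε ≤ ((1 / (n : ℝ) : ℝ) : EReal) * CKA.channelEhGE (CKA.tensorPower N n) ε := by
  refine ⟨sSup_le ?_, CKA.channelEhGE_eq_pure hN hε.1 hε.2, fun n _ => sSup_le ?_⟩
  · rintro _ ⟨K, hK, rfl⟩
    exact hK.logb_le hN
  · rintro _ ⟨K, hK, rfl⟩
    rw [EReal.coe_mul]
    exact mul_le_mul_of_nonneg_left (hK.logb_le (hN.tensorPower n))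
      (EReal.coe_nonneg.2 (by positivity))
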